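/- Let $V$ be an $n$-dimensional vector space over a finite field $\mathbb{F}_q$, and for each $j$ let $\Omega_j$ be the set of $j$-dimensional subspaces of $V$. Let $k,\ell\geq 1$ be integers with $n\geq 2k$ and $n\geq 2\ell$, and let $\mathscr{F}\subseteq\Omega_k$ and $\mathscr{G}\subseteq\Omega_\ell$ be families such that $x\cap y\neq 0$ for all $x\in\mathscr{F}$ and $y\in\mathscr{G}$. Then $$|\mathscr{F}|\,|\mathscr{G}|\leq \binom{n-1}{k-1}_q\binom{n-1}{\ell-1}_q,\qquad\text{where}\quad \binom{a}{b}_q=\prod_{i=0}^{b-1}\frac{q^{a-i}-1}{q^{b-i}-1}.$$ Equality holds if and only if one of the following holds: (i) there is $z\in\Omega_1$ such that $\mathscr{F}=\{x\in\Omega_k : z\subseteq x\}$ and $\mathscr{G}=\{x\in\Omega_\ell : z\subseteq x\}$; (ii) $n=2k=2\ell$ and there is $z\in\Omega_{2k-1}$ such that $\mathscr{F}=\mathscr{G}=\{x\in\Omega_k : x\subseteq z\}$. -/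

import Mathlib

/-- The set of all `k`-dimensional subspaces of the vector space `V` over `K`. -/
def subspacesOfDim (K V : Type*) [Field K] [AddCommGroup V] [Module K V] (k : ℕ) :
    Set (Submodule K V) :=
  {x | Module.finrank K x = k}

/-- Two families of subspaces are cross-intersecting if every member of the first meets
every member of the second nontrivially. -/
def CrossIntersecting {K V : Type*} [Field K] [AddCommGroup V] [Module K V]
    (F G : Set (Submodule K V)) : Prop :=
  ∀ x ∈ F, ∀ y ∈ G, x ⊓ y ≠ ⊥

/-- The Gaussian coefficient `∏_{i=0}^{b-1} (q^(a-i) - 1) / (q^(b-i) - 1)`, as a rational number.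
The subtraction `a - i` is exact when `b ≤ a`; when `a < b`, the factor `i = a` is zero, as it is
with integer exponents. -/
def gaussianCoeff (q a b : ℕ) : ℚ :=
  ∏ i ∈ Finset.range b, ((q : ℚ) ^ (a - i) - 1) / ((q : ℚ) ^ (b - i) - 1)

open Module Submodule

/-! The proof is spectral. Write `A`, `B` for the two Gaussian coefficients of the bound, `D` for
the operator summing a function over the subspaces that meet a given one trivially (`disjSum`), and
take `k ≤ l`. For functions `f` on `k`-spaces and `g` on `l`-spaces consider `Q = B‖f‖² + A‖g‖² -
2(∑f)(∑g) + 2γ⟨f, D g⟩ - t⟨g, D g⟩`. The heart is `quadratic_certificate`: for suitable `γ > 0` and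
`t ≥ 0` (`exists_multipliers`) the form is nonnegative, and it vanishes only if `f` and `g` are sums
over points of one common function `φ`.

Put `f = s·1_F` and `g = s⁻¹·1_G`. Cross-intersection gives `⟨f, D g⟩ = 0`, and `⟨g, D g⟩ ≥ 0`, so
`2|F||G| ≤ B s²|F| + A s⁻²|G|`. Choosing `s` to balance the right side gives `|F||G| ≤ AB`.

Nonnegativity comes from splitting `g` into harmonic parts (`exists_harmonic_decomposition`), which
are mutually orthogonal and on which `D` acts by explicit scalars. Completing the square in `f`
leaves a form in `g` alone. The multipliers make it vanish in degrees 0 and 1, and it is positive in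
every degree from 2 to `l`.

In case of equality `φ` sums to zero over each `l`-space disjoint from a member of `F`, and
symmetrically. If `k + l < n`, averaging forces `φ` to vanish off every member (`eq_zero_off`), so a
point with `φ ≠ 0` lies in all members. Otherwise `n = 2k = 2l` and `F = G`; if `φ` does not vanish
off every member, the members are exactly the `k`-spaces on which `φ` is constantly maximal, and the
points of maximal value form a proper subspace (`exists_point_or_hyperplane`). Comparing
cardinalities then identifies the families. -/

lemma finite_quotient {K V : Type*} [Field K] [AddCommGroup V] [Module K V] [Finite V]
    (x : Submodule K V) : Finite (V ⧸ x) :=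
  Finite.of_surjective _ x.mkQ_surjective

/-! ### Counting subspaces with prescribed intersections. -/

section Counting

variable {K V : Type*} [Field K] [Finite K] [AddCommGroup V] [Module K V] [Finite V]

/-- The Gaussian coefficient with a real base. -/
noncomputable def qBinom (q : ℝ) (m b : ℕ) : ℝ :=
  ∏ i ∈ Finset.range b, (q ^ (m - i) - 1) / (q ^ (b - i) - 1)

lemma gaussianCoeff_cast (q a b : ℕ) : ((gaussianCoeff q a b : ℚ) : ℝ) = qBinom q a b := by
  simp [gaussianCoeff, qBinom]

/-- A linear section of the quotient map splits each vector into its class modulo `x` and a free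
component in `x`. -/
lemma card_tuples_linearIndependent_mkQ (x : Submodule K V) (l : ℕ)
    (h : finrank K x + l ≤ finrank K V) :
    Nat.card {s : Fin l → V // LinearIndependent K (x.mkQ ∘ s)} =
      (Nat.card K ^ finrank K x) ^ l *
        ∏ i : Fin l, (Nat.card K ^ (finrank K V - finrank K x) - Nat.card K ^ (i : ℕ)) := by
  obtain ⟨σ, hσ⟩ := x.mkQ.exists_rightInverse_of_surjective x.range_mkQ
  have hσ' (v : V ⧸ x) : x.mkQ (σ v) = v := LinearMap.congr_fun hσ v
  have hx {v : V} : v ∈ x ↔ x.mkQ v = 0 := (Submodule.Quotient.mk_eq_zero x).symm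
  let e : {s : Fin l → V // LinearIndependent K (x.mkQ ∘ s)} ≃
      {s : Fin l → V ⧸ x // LinearIndependent K s} × (Fin l → x) :=
    { toFun := fun s => (⟨x.mkQ ∘ s.1, s.2⟩, fun i => ⟨s.1 i - σ (x.mkQ (s.1 i)), by
        rw [hx, map_sub, hσ', sub_self]⟩)
      invFun := fun p => ⟨fun i => σ (p.1.1 i) + p.2 i, by
        have : x.mkQ ∘ (fun i => σ (p.1.1 i) + (p.2 i : V)) = p.1.1 := by
          funext i
          simp only [Function.comp, map_add, hσ', hx.1 (p.2 i).2, add_zero]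
        rw [this]; exact p.1.2⟩
      left_inv := fun s => by
        ext i; simp
      right_inv := fun p => by
        refine Prod.ext (Subtype.ext ?_) ?_
        · funext i
          simp only [Function.comp, map_add, hσ', hx.1 (p.2 i).2, add_zero]
        · funext i
          refine Subtype.ext ?_
          simp only [map_add, hσ', hx.1 (p.2 i).2, add_zero, add_sub_cancel_left] }
  have := Fintype.ofFinite K
  have := finite_quotient x
  have hd := x.finrank_quotient_add_finrank
  rw [Nat.card_congr e, Nat.card_prod, card_linearIndependent (by omega), Nat.card_fun,
    Module.natCard_eq_pow_finrank (K := K) (V := x), mul_comm, Nat.card_fin,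
    show finrank K (V ⧸ x) = finrank K V - finrank K x by omega, Nat.card_eq_fintype_card]

/-- A subspace `y` disjoint from `x` together with an ordered basis of `y` is the same thing as an
`l`-tuple independent modulo `x`: the tuple recovers `y` as its span. -/
lemma card_disjoint_mul (x : Submodule K V) (l : ℕ) (h : finrank K x + l ≤ finrank K V) :
    Nat.card {y : Submodule K V // finrank K y = l ∧ y ⊓ x = ⊥} *
        ∏ i : Fin l, (Nat.card K ^ l - Nat.card K ^ (i : ℕ)) =
      (Nat.card K ^ finrank K x) ^ l *
        ∏ i : Fin l, (Nat.card K ^ (finrank K V - finrank K x) - Nat.card K ^ (i : ℕ)) := by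
  rw [← card_tuples_linearIndependent_mkQ x l h]
  let f : (Σ y : {y : Submodule K V // finrank K y = l ∧ y ⊓ x = ⊥},
      {t : Fin l → y.1 // LinearIndependent K t}) →
      {s : Fin l → V // LinearIndependent K (x.mkQ ∘ s)} := fun p =>
    ⟨fun i => (p.2.1 i : V), by
      have := p.2.2.map' (x.mkQ ∘ₗ p.1.1.subtype) (by
        rw [LinearMap.ker_comp, x.ker_mkQ, ← Submodule.disjoint_iff_comap_eq_bot, disjoint_iff]
        exact p.1.2.2)
      exact this⟩
  have hspan (p) : span K (Set.range (f p).1) = p.1.1 := by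
    have h1 : LinearIndependent K (f p).1 := LinearIndependent.of_comp _ (f p).2
    refine Submodule.eq_of_le_of_finrank_eq (span_le.2 ?_) ?_
    · rintro _ ⟨i, rfl⟩
      exact (p.2.1 i).2
    · rw [finrank_span_eq_card h1, Fintype.card_fin, p.1.2.1]
  have hf : Function.Bijective f := by
    constructor
    · rintro ⟨⟨y, hy⟩, t⟩ ⟨⟨y', hy'⟩, t'⟩ heq
      have : y = y' := by
        have := hspan ⟨⟨y, hy⟩, t⟩
        rw [heq, hspan] at this
        exact this.symm
      subst this
      congr
      ext i
      exact congrFun (congrArg Subtype.val heq) i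
    · rintro ⟨s, hs⟩
      have hli : LinearIndependent K s := LinearIndependent.of_comp _ hs
      have hdis : span K (Set.range s) ⊓ x = ⊥ := by
        have := Submodule.range_ker_disjoint hs
        rwa [x.ker_mkQ, disjoint_iff] at this
      refine ⟨⟨⟨span K (Set.range s), by rw [finrank_span_eq_card hli, Fintype.card_fin],
        hdis⟩, ⟨fun i => ⟨s i, subset_span ⟨i, rfl⟩⟩, ?_⟩⟩, rfl⟩
      exact LinearIndependent.of_comp (Submodule.subtype _) hli
  have := Fintype.ofFinite K
  have := Fintype.ofFinite {y : Submodule K V // finrank K y = l ∧ y ⊓ x = ⊥}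
  rw [← Nat.card_congr (Equiv.ofBijective f hf), Nat.card_sigma]
  rw [Finset.sum_congr rfl (fun y _ => by
    rw [card_linearIndependent y.2.1.ge, y.2.1])]
  simp [Nat.card_eq_fintype_card]

lemma one_lt_card_cast (K : Type*) [Field K] [Finite K] : (1 : ℝ) < (Nat.card K : ℝ) := by
  exact_mod_cast Finite.one_lt_card

lemma prod_pow_sub_pow (q : ℕ) (hq : 1 < q) (m l : ℕ) (hlm : l ≤ m) :
    ((∏ i : Fin l, (q ^ m - q ^ (i : ℕ)) : ℕ) : ℝ) =
      (∏ i ∈ Finset.range l, (q : ℝ) ^ i) * ∏ i ∈ Finset.range l, ((q : ℝ) ^ (m - i) - 1) := by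
  rw [Fin.prod_univ_eq_prod_range (fun i => q ^ m - q ^ i), ← Finset.prod_mul_distrib]
  push_cast
  refine Finset.prod_congr rfl fun i hi => ?_
  have hi' := Finset.mem_range.1 hi
  rw [Nat.cast_sub (Nat.pow_le_pow_right hq.le (by omega))]
  push_cast
  rw [mul_sub, ← pow_add, mul_one, show i + (m - i) = m by omega]

lemma card_disjoint (x : Submodule K V) (l : ℕ) (h : finrank K x + l ≤ finrank K V) :
    (Nat.card {y : Submodule K V // finrank K y = l ∧ y ⊓ x = ⊥} : ℝ) =
      (Nat.card K : ℝ) ^ (finrank K x * l) *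
        qBinom (Nat.card K) (finrank K V - finrank K x) l := by
  have hq := one_lt_card_cast K
  have h0 := congrArg (Nat.cast (R := ℝ)) (card_disjoint_mul x l h)
  rw [Nat.cast_mul, Nat.cast_mul, prod_pow_sub_pow _ Finite.one_lt_card _ _ le_rfl,
    prod_pow_sub_pow _ Finite.one_lt_card _ _ (by omega)] at h0
  have hne : (∏ i ∈ Finset.range l, (Nat.card K : ℝ) ^ i) ≠ 0 :=
    Finset.prod_ne_zero_iff.2 fun i _ => pow_ne_zero _ (by linarith)
  have hne2 : (∏ i ∈ Finset.range l, ((Nat.card K : ℝ) ^ (l - i) - 1)) ≠ 0 := by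
    refine Finset.prod_ne_zero_iff.2 fun i hi => ?_
    have hi' := Finset.mem_range.1 hi
    have := one_lt_pow₀ hq (n := l - i) (by omega)
    linarith
  rw [qBinom, Finset.prod_div_distrib, ← mul_div_assoc, eq_div_iff hne2]
  refine mul_left_cancel₀ hne ?_
  push_cast at h0
  rw [pow_mul]
  linear_combination h0

/-- In `V ⧸ u` the condition `y ⊓ w ≤ u` becomes disjointness from the image of `w`, by modularity.
The later counts of subspaces are specializations: intervals (`w = ⊥`), spaces above `u` disjoint
from `w`, and spaces meeting `w` exactly in a point. -/
lemma card_above_inf_le (u w : Submodule K V) (l : ℕ) (hl : finrank K u ≤ l)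
    (h : finrank K w - finrank K (u ⊓ w : Submodule K V) + l ≤ finrank K V) :
    (Nat.card {y : Submodule K V // finrank K y = l ∧ u ≤ y ∧ y ⊓ w ≤ u} : ℝ) =
      (Nat.card K : ℝ) ^ ((finrank K w - finrank K (u ⊓ w : Submodule K V)) *
          (l - finrank K u)) *
        qBinom (Nat.card K)
          (finrank K V - finrank K u - (finrank K w - finrank K (u ⊓ w : Submodule K V)))
          (l - finrank K u) := by
  have := finite_quotient u
  have hd := u.finrank_quotient_add_finrank
  have hmap (y : Submodule K V) : finrank K (y.map u.mkQ) =
      finrank K y - finrank K (u ⊓ y : Submodule K V) := by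
    have h1 := (u.mkQ.domRestrict y).finrank_range_add_finrank_ker
    rw [LinearMap.range_domRestrict] at h1
    have h2 : finrank K (u.mkQ.domRestrict y).ker = finrank K (u ⊓ y : Submodule K V) := by
      rw [LinearMap.ker_domRestrict, u.ker_mkQ, inf_comm]
      have := Submodule.finrank_map_subtype_eq y (u.comap y.subtype)
      rw [← this, Submodule.map_comap_subtype]
    omega
  have hcard := card_disjoint (w.map u.mkQ) (l - finrank K u) (by rw [hmap]; omega)
  rw [hmap, show finrank K (V ⧸ u) = finrank K V - finrank K u by omega] at hcard
  rw [← hcard]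
  congr 1
  refine Nat.card_congr ?_
  refine ⟨fun y => ⟨y.1.map u.mkQ, ?_, ?_⟩, fun y => ⟨y.1.comap u.mkQ, ?_, ?_, ?_⟩, ?_, ?_⟩
  · rw [hmap, y.2.1, inf_eq_left.2 y.2.2.1]
  · have h1 : (y.1.map u.mkQ ⊓ w.map u.mkQ).comap u.mkQ ≤ u := by
      rw [Submodule.comap_inf, Submodule.comap_map_mkQ, Submodule.comap_map_mkQ,
        sup_eq_right.2 y.2.2.1, inf_comm, sup_inf_assoc_of_le _ y.2.2.1]
      exact sup_le le_rfl (by rw [inf_comm]; exact y.2.2.2)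
    rw [eq_bot_iff]
    refine (Submodule.comap_le_comap_iff_of_surjective u.mkQ_surjective).1 ?_
    rwa [Submodule.comap_bot, u.ker_mkQ]
  · have h1 := hmap (y.1.comap u.mkQ)
    rw [Submodule.map_comap_eq_of_surjective u.mkQ_surjective,
      inf_eq_left.2 (Submodule.le_comap_mkQ _ _), y.2.1] at h1
    have h2 := Submodule.finrank_mono (Submodule.le_comap_mkQ u y.1)
    omega
  · exact Submodule.le_comap_mkQ _ _
  · have h1 : (y.1.comap u.mkQ ⊓ w).map u.mkQ ≤ y.1 ⊓ w.map u.mkQ :=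
      le_inf ((Submodule.map_mono inf_le_left).trans (Submodule.map_comap_le _ _))
        (Submodule.map_mono inf_le_right)
    rw [y.2.2, Submodule.map_le_iff_le_comap, Submodule.comap_bot, u.ker_mkQ] at h1
    exact h1
  · intro y
    refine Subtype.ext ?_
    simp only [Submodule.comap_map_mkQ]
    exact sup_eq_right.2 y.2.2.1
  · intro y
    exact Subtype.ext (Submodule.map_comap_eq_of_surjective u.mkQ_surjective _)

lemma card_Icc (z y : Submodule K V) (hzy : z ≤ y) (i : ℕ) (hzi : finrank K z ≤ i)
    (hiy : i ≤ finrank K y) :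
    (Nat.card {w : Submodule K V // finrank K w = i ∧ z ≤ w ∧ w ≤ y} : ℝ) =
      qBinom (Nat.card K) (finrank K y - finrank K z) (i - finrank K z) := by
  have hz : finrank K (z.comap y.subtype) = finrank K z := by
    rw [← Submodule.finrank_map_subtype_eq, Submodule.map_comap_subtype, inf_eq_right.2 hzy]
  have h := card_above_inf_le (z.comap y.subtype) (⊥ : Submodule K y) i (by omega) (by
    rw [finrank_bot]; omega)
  rw [finrank_bot, hz] at h
  simp only [Nat.zero_sub, zero_mul, pow_zero, one_mul, Nat.sub_zero] at h
  rw [← h]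
  congr 1
  refine Nat.card_congr ⟨fun w => ⟨w.1.comap y.subtype, ?_, ?_, ?_⟩,
    fun w => ⟨w.1.map y.subtype, ?_, ?_, ?_⟩, ?_, ?_⟩
  · rw [← Submodule.finrank_map_subtype_eq, Submodule.map_comap_subtype, inf_eq_right.2 w.2.2.2,
      w.2.1]
  · exact Submodule.comap_mono w.2.2.1
  · simp
  · rw [Submodule.finrank_map_subtype_eq, w.2.1]
  · have := Submodule.map_mono (f := y.subtype) w.2.2.1
    rwa [Submodule.map_comap_subtype, inf_eq_right.2 hzy] at this
  · exact Submodule.map_subtype_le _ _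
  · intro w
    exact Subtype.ext (by simp only [Submodule.map_comap_subtype]; exact inf_eq_right.2 w.2.2.2)
  · intro w
    exact Subtype.ext (Submodule.comap_map_eq_of_injective y.injective_subtype _)

end Counting

/-! ### Identities for Gaussian coefficients. -/

section QBinom

/-- The `q`-factorial, up to the factor `(q - 1) ^ m`. -/
noncomputable def qFact (q : ℝ) (m : ℕ) : ℝ := ∏ i ∈ Finset.range m, (q ^ (i + 1) - 1)

variable {q : ℝ}

lemma pow_sub_one_pos (hq : 1 < q) {m : ℕ} (hm : m ≠ 0) : 0 < q ^ m - 1 := by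
  have := one_lt_pow₀ hq hm
  linarith

lemma qFact_pos (hq : 1 < q) (m : ℕ) : 0 < qFact q m :=
  Finset.prod_pos fun _ _ => pow_sub_one_pos hq (by omega)

lemma qBinom_eq_prod_div (q : ℝ) (m b : ℕ) :
    qBinom q m b = (∏ i ∈ Finset.range b, (q ^ (m - i) - 1)) / qFact q b := by
  rw [qBinom, Finset.prod_div_distrib, qFact,
    ← Finset.prod_range_reflect (fun i => q ^ (i + 1) - 1)]
  congr 1
  refine Finset.prod_congr rfl fun i hi => ?_
  have := Finset.mem_range.1 hi
  rw [show b - 1 - i + 1 = b - i by omega]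

lemma qBinom_zero_right (q : ℝ) (m : ℕ) : qBinom q m 0 = 1 := by simp [qBinom]

lemma qBinom_succ_succ (q : ℝ) (m b : ℕ) :
    qBinom q (m + 1) (b + 1) = (q ^ (m + 1) - 1) / (q ^ (b + 1) - 1) * qBinom q m b := by
  rw [qBinom, Finset.prod_range_succ', qBinom, mul_comm]
  simp

lemma qBinom_pos (hq : 1 < q) {m b : ℕ} (h : b ≤ m) : 0 < qBinom q m b := by
  refine Finset.prod_pos fun i hi => ?_
  have := Finset.mem_range.1 hi
  exact div_pos (pow_sub_one_pos hq (by omega)) (pow_sub_one_pos hq (by omega))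

lemma qBinom_succ_right (hq : 1 < q) (m i : ℕ) :
    qBinom q m (i + 1) * (q ^ (i + 1) - 1) = (q ^ (m - i) - 1) * qBinom q m i := by
  have h1 := (qFact_pos hq i).ne'
  have h2 := (pow_sub_one_pos hq (Nat.succ_ne_zero i)).ne'
  rw [qBinom_eq_prod_div, qBinom_eq_prod_div, Finset.prod_range_succ,
    show qFact q (i + 1) = qFact q i * (q ^ (i + 1) - 1) from Finset.prod_range_succ _ _]
  field_simp

lemma qBinom_mul_qFact (hq : 1 < q) (m b : ℕ) :
    qBinom q (m + b) b * (qFact q b * qFact q m) = qFact q (m + b) := by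
  induction b with
  | zero => simp [qBinom_zero_right, qFact]
  | succ b ih =>
    have h2 := (pow_sub_one_pos hq (Nat.succ_ne_zero b)).ne'
    rw [← add_assoc, qBinom_succ_succ,
      show qFact q (b + 1) = qFact q b * (q ^ (b + 1) - 1) from Finset.prod_range_succ _ _,
      show qFact q (m + b + 1) = qFact q (m + b) * (q ^ (m + b + 1) - 1) from
        Finset.prod_range_succ _ _, ← ih]
    field_simp

lemma qBinom_symm (hq : 1 < q) (m b : ℕ) : qBinom q (m + b) b = qBinom q (m + b) m := by
  have h1 := qBinom_mul_qFact hq m b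
  have h2 := qBinom_mul_qFact hq b m
  rw [add_comm b m] at h2
  have h3 := (mul_pos (qFact_pos hq b) (qFact_pos hq m)).ne'
  exact mul_right_cancel₀ h3 (by rw [h1, mul_comm (qFact q b), h2])

lemma qBinom_pascal (hq : 1 < q) {m i : ℕ} (h : i ≤ m) :
    qBinom q (m + 1) (i + 1) = qBinom q m i + q ^ (i + 1) * qBinom q m (i + 1) := by
  have h2 := (pow_sub_one_pos hq (show i + 1 ≠ 0 by omega)).ne'
  have h3 := qBinom_succ_right hq m i
  have h4 := qBinom_succ_succ q m i
  have h5 : q ^ (m + 1) = q ^ (i + 1) * q ^ (m - i) := by rw [← pow_add]; congr 1; omega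
  refine mul_right_cancel₀ h2 ?_
  rw [h4, div_mul_eq_mul_div, div_mul_cancel₀ _ h2, add_mul, mul_assoc, h3, h5]
  ring

lemma qBinom_self_succ (q : ℝ) (m : ℕ) : qBinom q m (m + 1) = 0 := by
  rw [qBinom, Finset.prod_range_succ]
  simp

/-- The value at a `j`-dimensional interval of the Möbius function of the subspace lattice. -/
noncomputable def qMoebius (q : ℝ) (j : ℕ) : ℝ := (-1) ^ j * q ^ (j.choose 2)

/-- The `q`-Pascal rule makes the sum telescope, since `qMoebius q (i + 1) = -(qMoebius q i * q ^
i)`. -/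
lemma sum_qMoebius_mul_qBinom (hq : 1 < q) (m : ℕ) :
    ∑ i ∈ Finset.range (m + 1), qMoebius q i * qBinom q m i = if m = 0 then 1 else 0 := by
  cases m with
  | zero => simp [qMoebius, qBinom_zero_right]
  | succ m =>
    have key (i : ℕ) (hi : i ∈ Finset.range (m + 1)) :
        qMoebius q (i + 1) * qBinom q (m + 1) (i + 1) =
          qMoebius q (i + 1) * q ^ (i + 1) * qBinom q m (i + 1) -
            qMoebius q i * q ^ i * qBinom q m i := by
      rw [qBinom_pascal hq (Nat.lt_succ_iff.1 (Finset.mem_range.1 hi))]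
      have : qMoebius q (i + 1) = - (qMoebius q i * q ^ i) := by
        rw [qMoebius, qMoebius, Nat.choose_succ_succ' i 1, Nat.choose_one_right, pow_add]
        ring
      rw [this]
      ring
    rw [Finset.sum_range_succ', Finset.sum_congr rfl key,
      Finset.sum_range_sub (fun i => qMoebius q i * q ^ i * qBinom q m i), qBinom_self_succ]
    simp [qBinom_zero_right, qMoebius]

end QBinom

/-! ### Eigenvalue estimates and the choice of multipliers. -/

section Eigenvalues

/-- The number of `l`-dimensional subspaces of an `n`-dimensional space that contain a given
`j`-dimensional subspace `z` and meet trivially a `k`-dimensional subspace disjoint from `z`. -/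
noncomputable def numDisjointAbove (q : ℝ) (n j k l : ℕ) : ℝ :=
  if j ≤ l then q ^ (k * (l - j)) * qBinom q (n - j - k) (l - j) else 0

variable {q : ℝ}

lemma numDisjointAbove_pos (hq : 1 < q) {n j k l : ℕ} (hj : j ≤ l) (h : k + l ≤ n) :
    0 < numDisjointAbove q n j k l := by
  rw [numDisjointAbove, if_pos hj]
  exact mul_pos (by positivity) (qBinom_pos hq (by omega))

lemma numDisjointAbove_nonneg (hq : 1 < q) {n j k l : ℕ} (h : k + l ≤ n) :
    0 ≤ numDisjointAbove q n j k l := by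
  by_cases hj : j ≤ l
  · exact (numDisjointAbove_pos hq hj h).le
  · rw [numDisjointAbove, if_neg hj]

/-- For `j < l` the ratio of consecutive values is `q ^ k` times a quotient `(q ^ (n - j - k) - 1) /
(q ^ (l - j) - 1)`, which is at least 1 because `k + l ≤ n`. -/
lemma numDisjointAbove_succ_le (hq : 1 < q) {n j k l : ℕ} (h : k + l ≤ n) :
    q ^ k * numDisjointAbove q n (j + 1) k l ≤ numDisjointAbove q n j k l := by
  by_cases hj : j + 1 ≤ l
  · obtain ⟨a, rfl⟩ := Nat.exists_eq_add_of_le hj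
    obtain ⟨b, rfl⟩ := Nat.exists_eq_add_of_le h
    rw [numDisjointAbove, numDisjointAbove, if_pos hj, if_pos (by omega),
      show k + (j + 1 + a) + b - (j + 1) - k = a + b by omega,
      show k + (j + 1 + a) + b - j - k = a + b + 1 by omega,
      show j + 1 + a - (j + 1) = a by omega, show j + 1 + a - j = a + 1 by omega,
      qBinom_succ_succ, ← mul_assoc, ← mul_assoc, ← pow_add]
    have h1 : 1 ≤ (q ^ (a + b + 1) - 1) / (q ^ (a + 1) - 1) := by
      rw [one_le_div (pow_sub_one_pos hq (by omega))]
      have := pow_le_pow_right₀ hq.le (show a + 1 ≤ a + b + 1 by omega)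
      linarith
    have h2 := qBinom_pos hq (show a ≤ a + b by omega)
    have h3 : 0 < q ^ (k * (a + 1)) := by positivity
    rw [show k + k * a = k * (a + 1) by ring]
    gcongr
    nlinarith
  · rw [numDisjointAbove, if_neg hj, mul_zero]
    exact numDisjointAbove_nonneg hq h

lemma pow_mul_numDisjointAbove_le (hq : 1 < q) {n k l : ℕ} (h : k + l ≤ n) (d : ℕ) :
    q ^ (k * d) * numDisjointAbove q n (d + 1) k l ≤ numDisjointAbove q n 1 k l := by
  induction d with
  | zero => simp
  | succ d ih =>
    refine le_trans ?_ ih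
    rw [mul_add, mul_one, pow_add, mul_assoc]
    gcongr
    exact numDisjointAbove_succ_le hq h

/-- In the notation of `exists_multipliers` this says `γN' = A(qⁿ - qᵏ)/(qⁿ - qˡ)`, which controls
both the sign and the size of `t`. -/
lemma numDisjointAbove_one_ratio (hq : 1 < q) {n k l : ℕ} (hk : 1 ≤ k) (hl : 1 ≤ l)
    (h : k + l ≤ n) :
    qBinom q (n - 1) (l - 1) * numDisjointAbove q n 1 l k * (q ^ n - q ^ l) =
      qBinom q (n - 1) (k - 1) * numDisjointAbove q n 1 k l * (q ^ n - q ^ k) := by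
  obtain ⟨a, rfl⟩ := Nat.exists_eq_add_of_le' hk
  obtain ⟨b, rfl⟩ := Nat.exists_eq_add_of_le' hl
  obtain ⟨c, rfl⟩ := Nat.exists_eq_add_of_le h
  rw [numDisjointAbove, numDisjointAbove, if_pos hk, if_pos hl]
  simp only [Nat.add_sub_cancel]
  rw [show a + 1 + (b + 1) + c - 1 - (b + 1) = c + a by omega,
    show a + 1 + (b + 1) + c - 1 - (a + 1) = c + b by omega,
    show a + 1 + (b + 1) + c - 1 = a + c + 1 + b by omega,
    show a + 1 + (b + 1) + c = a + b + c + 2 by omega]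
  have e1 := qBinom_mul_qFact hq c a
  have e2 := qBinom_mul_qFact hq c b
  have e3 := qBinom_mul_qFact hq (a + c + 1) b
  have e4 := qBinom_mul_qFact hq (b + c + 1) a
  rw [show b + c + 1 + a = a + c + 1 + b by omega] at e4
  have f1 : qFact q (a + c + 1) = qFact q (c + a) * (q ^ (a + c + 1) - 1) := by
    rw [add_comm c a]; exact Finset.prod_range_succ _ _
  have f2 : qFact q (b + c + 1) = qFact q (c + b) * (q ^ (b + c + 1) - 1) := by
    rw [add_comm c b]; exact Finset.prod_range_succ _ _
  have pa := (qFact_pos hq a).ne'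
  have pb := (qFact_pos hq b).ne'
  have pc := (qFact_pos hq c).ne'
  have pca := (qFact_pos hq (c + a)).ne'
  have pcb := (qFact_pos hq (c + b)).ne'
  have p1 := (pow_sub_one_pos hq (show a + c + 1 ≠ 0 by omega)).ne'
  have p2 := (pow_sub_one_pos hq (show b + c + 1 ≠ 0 by omega)).ne'
  rw [f1] at e3
  rw [f2] at e4
  have g1 := eq_div_of_mul_eq (mul_ne_zero pa pc) e1
  have g2 := eq_div_of_mul_eq (mul_ne_zero pb pc) e2
  have g3 := eq_div_of_mul_eq (mul_ne_zero pb (mul_ne_zero pca p1)) e3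
  have g4 := eq_div_of_mul_eq (mul_ne_zero pa (mul_ne_zero pcb p2)) e4
  rw [g1, g2, g3, g4,
    show q ^ (a + b + c + 2) - q ^ (b + 1) = q ^ (b + 1) * (q ^ (a + c + 1) - 1) by ring,
    show q ^ (a + b + c + 2) - q ^ (a + 1) = q ^ (a + 1) * (q ^ (b + c + 1) - 1) by ring]
  generalize q ^ (a + c + 1) - 1 = X at *
  generalize q ^ (b + c + 1) - 1 = Y at *
  field_simp
  ring

/-- The Möbius factor `q ^ (j.choose 2)` is absorbed by the decay `q ^ (l * (j - 1))` of
`numDisjointAbove`. -/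
lemma abs_qMoebius_mul_le (hq : 1 < q) {n j l : ℕ} (h : 2 * l ≤ n) (hj : 1 ≤ j) (hjl : j ≤ l) :
    |qMoebius q j * numDisjointAbove q n j l l| ≤ numDisjointAbove q n 1 l l := by
  obtain ⟨d, rfl⟩ := Nat.exists_eq_add_of_le' hj
  have h0 := numDisjointAbove_nonneg hq (j := d + 1) (show l + l ≤ n by omega)
  have hq0 : 0 < q := by linarith
  rw [abs_mul, abs_of_nonneg h0, qMoebius, abs_mul, abs_pow, abs_neg, abs_one, one_pow, one_mul,
    abs_of_pos (by positivity)]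
  refine le_trans ?_ (pow_mul_numDisjointAbove_le hq (show l + l ≤ n by omega) d)
  gcongr
  · exact hq.le
  · rw [Nat.choose_two_right]
    refine Nat.div_le_of_le_mul ?_
    simp only [Nat.add_sub_cancel]
    nlinarith

lemma qMoebius_sq_mul_le (hq : 2 ≤ q) {n j k l : ℕ} (h : k + l ≤ n) (hkl : k ≤ l) (hj : 2 ≤ j) :
    4 * (qMoebius q j ^ 2 * (numDisjointAbove q n j k l * numDisjointAbove q n j l k)) ≤
      numDisjointAbove q n 1 k l * numDisjointAbove q n 1 l k := by
  have hq1 : 1 < q := by linarith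
  have n1 := numDisjointAbove_nonneg hq1 (j := 1) h
  have n2 := numDisjointAbove_nonneg hq1 (j := 1) (show l + k ≤ n by omega)
  by_cases hjk : j ≤ k
  · obtain ⟨d, rfl⟩ := Nat.exists_eq_add_of_le' (show 1 ≤ j by omega)
    have h1 := pow_mul_numDisjointAbove_le hq1 h d
    have h2 := pow_mul_numDisjointAbove_le hq1 (show l + k ≤ n by omega) d
    have m1 := numDisjointAbove_nonneg hq1 (j := d + 1) h
    have m2 := numDisjointAbove_nonneg hq1 (j := d + 1) (show l + k ≤ n by omega)
    have h3 : 4 * qMoebius q (d + 1) ^ 2 ≤ q ^ (k * d) * q ^ (l * d) := by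
      have hc : (d + 1).choose 2 * 2 = (d + 1) * d := by
        rw [Nat.choose_two_right, Nat.div_mul_cancel (Nat.even_mul_pred_self _).two_dvd,
          Nat.add_sub_cancel]
      have : qMoebius q (d + 1) ^ 2 = q ^ ((d + 1) * d) := by
        rw [qMoebius, mul_pow, ← pow_mul, ← pow_mul, hc, mul_comm (d + 1) 2, pow_mul]
        simp
      rw [this, ← pow_add]
      calc 4 * q ^ ((d + 1) * d) ≤ q ^ 2 * q ^ ((d + 1) * d) := by gcongr; nlinarith
        _ = q ^ (2 + (d + 1) * d) := by rw [pow_add]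
        -- Both `k` and `l` are at least `d + 1` and `d ≥ 1`, so `(k + l)d ≥ 2(d + 1)d ≥ (d + 1)d +
        -- 2`; the spare `q ^ 2` pays for the factor 4.
        _ ≤ q ^ (k * d + l * d) := by
          refine pow_le_pow_right₀ hq1.le ?_
          nlinarith
    calc _ = (4 * qMoebius q (d + 1) ^ 2) * (numDisjointAbove q n (d + 1) k l *
          numDisjointAbove q n (d + 1) l k) := by ring
      _ ≤ (q ^ (k * d) * q ^ (l * d)) * (numDisjointAbove q n (d + 1) k l *
          numDisjointAbove q n (d + 1) l k) := by gcongr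
      _ = (q ^ (k * d) * numDisjointAbove q n (d + 1) k l) *
          (q ^ (l * d) * numDisjointAbove q n (d + 1) l k) := by ring
      _ ≤ _ := by gcongr
  · rw [show numDisjointAbove q n j l k = 0 from if_neg hjk]
    simp only [mul_zero]
    positivity

/-- The multipliers of the quadratic form certificate, and the facts about them that make it
positive. -/
lemma exists_multipliers (hq : 2 ≤ q) {n k l : ℕ} (hk : 1 ≤ k) (hkl : k ≤ l) (h : 2 * l ≤ n) :
    ∃ γ t : ℝ, 0 < γ ∧ 0 ≤ t ∧
      γ * numDisjointAbove q n 1 k l = qBinom q (n - 1) (l - 1) ∧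
      γ * numDisjointAbove q n 1 l k - t * numDisjointAbove q n 1 l l =
        qBinom q (n - 1) (k - 1) ∧
      ∀ j, 2 ≤ j → j ≤ l →
        0 < qBinom q (n - 1) (k - 1) - t * (qMoebius q j * numDisjointAbove q n j l l) -
          γ ^ 2 * (qMoebius q j ^ 2 * (numDisjointAbove q n j k l * numDisjointAbove q n j l k)) /
            qBinom q (n - 1) (l - 1) := by
  have hq1 : 1 < q := by linarith
  have hN := numDisjointAbove_pos hq1 (n := n) (j := 1) (k := k) (l := l) (by omega) (by omega)
  have hN' := numDisjointAbove_pos hq1 (n := n) (j := 1) (k := l) (l := k) (by omega) (by omega)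
  have hNl := numDisjointAbove_pos hq1 (n := n) (j := 1) (k := l) (l := l) (by omega) (by omega)
  have hA : 0 < qBinom q (n - 1) (k - 1) := qBinom_pos hq1 (by omega)
  have hB : 0 < qBinom q (n - 1) (l - 1) := qBinom_pos hq1 (by omega)
  have hr := numDisjointAbove_one_ratio hq1 hk (hk.trans hkl) (show k + l ≤ n by omega)
  have hM1 := fun j hj hjl => abs_qMoebius_mul_le hq1 (n := n) (j := j) (l := l) h hj hjl
  have hM2 := fun j hj => qMoebius_sq_mul_le hq (n := n) (j := j) (k := k) (l := l)
    (by omega) hkl hj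
  generalize qBinom q (n - 1) (k - 1) = A at *
  generalize qBinom q (n - 1) (l - 1) = B at *
  generalize numDisjointAbove q n 1 k l = N at *
  generalize numDisjointAbove q n 1 l k = N' at *
  generalize numDisjointAbove q n 1 l l = Nl at *
  have hnl : 0 < q ^ n - q ^ l := by
    have := pow_lt_pow_right₀ hq1 (show l < n by omega)
    linarith
  have hlk : q ^ k ≤ q ^ l := pow_le_pow_right₀ hq1.le hkl
  have hγ : 0 < B / N := div_pos hB hN
  have hγN : B / N * N = B := div_mul_cancel₀ _ hN.ne'
  have hr' : B / N * N' * (q ^ n - q ^ l) = A * (q ^ n - q ^ k) := by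
    rw [div_mul_eq_mul_div, div_mul_eq_mul_div, hr]
    field_simp
  generalize B / N = γ at *
  -- This is where `k ≤ l` gives `t ≥ 0`.
  have hge : A ≤ γ * N' := by
    by_contra! hlt
    have := mul_lt_mul_of_pos_right hlt hnl
    nlinarith
  refine ⟨γ, (γ * N' - A) / Nl, hγ, div_nonneg (by linarith) hNl.le, hγN, ?_, ?_⟩
  · rw [div_mul_cancel₀ _ hNl.ne']; ring
  · intro j hj hjl
    have hl2 : 2 ≤ l := hj.trans hjl
    -- A degree `j ≥ 2` forces `n ≥ 2l ≥ l + 2`, hence `qⁿ ≥ 4qˡ` and `(qⁿ - qᵏ)/(qⁿ - qˡ) ≤ 4/3`.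
    have h43 : 3 * (γ * N') ≤ 4 * A := by
      have h4 : 4 * q ^ l ≤ q ^ n := by
        calc 4 * q ^ l ≤ q ^ 2 * q ^ l := by gcongr; nlinarith
          _ = q ^ (2 + l) := by rw [pow_add]
          _ ≤ q ^ n := pow_le_pow_right₀ hq1.le (by omega)
      have hk0 : 0 < q ^ k := by positivity
      by_contra! hlt
      have := mul_lt_mul_of_pos_right hlt hnl
      nlinarith
    have h1 := hM1 j (by omega) hjl
    have h2 := hM2 j hj
    generalize qMoebius q j * numDisjointAbove q n j l l = E at *
    generalize qMoebius q j ^ 2 * (numDisjointAbove q n j k l * numDisjointAbove q n j l k) = S at *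
    have ht : (γ * N' - A) / Nl * E ≤ γ * N' - A := by
      rw [div_mul_eq_mul_div, div_le_iff₀ hNl]
      exact mul_le_mul_of_nonneg_left ((le_abs_self E).trans h1) (by linarith)
    have hs : γ ^ 2 * S / B ≤ γ * N' / 4 := by
      rw [div_le_iff₀ hB, ← hγN]
      nlinarith [mul_le_mul_of_nonneg_left h2 (sq_nonneg γ)]
    -- The quantity is at least `A - (γN' - A) - γN'/4 = 2A - (5/4)γN' ≥ A/3`.
    linarith

end Eigenvalues

/-! ### Harmonic functions on the subspace lattice. -/

section Harmonic

open scoped Classical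

variable {K V : Type*} [Field K] [AddCommGroup V] [Module K V] [Finite V]

/-- The `j`-dimensional subspaces of a finite vector space, as a finset. -/
noncomputable def grass (K V : Type*) [Field K] [AddCommGroup V] [Module K V] [Finite V]
    (j : ℕ) : Finset (Submodule K V) :=
  (subspacesOfDim K V j).toFinite.toFinset

lemma mem_grass {j : ℕ} {y : Submodule K V} : y ∈ grass K V j ↔ finrank K y = j := by
  simp [grass, subspacesOfDim]

lemma sum_grass_eq_sum_ite [Fintype (Submodule K V)] (j : ℕ) (f : Submodule K V → ℝ) :
    ∑ z ∈ grass K V j, f z = ∑ z : Submodule K V, if finrank K z = j then f z else 0 := by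
  rw [← Finset.sum_filter]
  exact Finset.sum_congr (by ext; simp [mem_grass]) fun _ _ => rfl

/-- The function on subspaces whose value at `x` is the sum of `φ` over the `j`-dimensional
subspaces of `x`. -/
noncomputable def upSum (j : ℕ) (φ : Submodule K V → ℝ) (x : Submodule K V) : ℝ :=
  ∑ z ∈ grass K V j, if z ≤ x then φ z else 0

/-- The sum of `g` over the `l`-dimensional subspaces that meet `x` trivially. -/
noncomputable def disjSum (l : ℕ) (g : Submodule K V → ℝ) (x : Submodule K V) : ℝ :=
  ∑ y ∈ grass K V l, if y ⊓ x = ⊥ then g y else 0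

/-- A function on `j`-dimensional subspaces is harmonic if its sums over the subspaces containing
a fixed subspace of smaller dimension vanish. -/
def IsHarmonic (j : ℕ) (φ : Submodule K V → ℝ) : Prop :=
  ∀ w : Submodule K V, finrank K w < j → ∑ z ∈ grass K V j, (if w ≤ z then φ z else 0) = 0

lemma upSum_sum_mul {ι : Type*} (s : Finset ι) (j : ℕ) (c : ι → ℝ) (φ : ι → Submodule K V → ℝ)
    (y : Submodule K V) :
    upSum j (fun z => ∑ i ∈ s, c i * φ i z) y = ∑ i ∈ s, c i * upSum j (φ i) y := by
  simp only [upSum, Finset.mul_sum]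
  rw [Finset.sum_comm]
  refine Finset.sum_congr rfl fun z _ => ?_
  split_ifs <;> simp

lemma isHarmonic_sum_mul {ι : Type*} (s : Finset ι) (j : ℕ) (c : ι → ℝ)
    (φ : ι → Submodule K V → ℝ) (h : ∀ i ∈ s, IsHarmonic j (φ i)) :
    IsHarmonic j (fun z => ∑ i ∈ s, c i * φ i z) := by
  intro w hw
  have h1 (z : Submodule K V) : (if w ≤ z then ∑ i ∈ s, c i * φ i z else 0) =
      ∑ i ∈ s, c i * (if w ≤ z then φ i z else 0) := by
    split_ifs <;> simp
  rw [Finset.sum_congr rfl fun z _ => h1 z, Finset.sum_comm]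
  refine Finset.sum_eq_zero fun i hi => ?_
  rw [← Finset.mul_sum, h i hi w hw, mul_zero]

lemma sum_grass_ite_one (l : ℕ) (p : Submodule K V → Prop) [DecidablePred p] :
    ∑ y ∈ grass K V l, (if p y then (1 : ℝ) else 0) =
      Nat.card {y : Submodule K V // finrank K y = l ∧ p y} := by
  rw [Finset.sum_boole, Nat.subtype_card _ (fun y => ?_)]
  rw [Finset.mem_filter, mem_grass]

variable [Finite K]

lemma sum_grass_Icc {z y : Submodule K V} (hzy : z ≤ y) {i : ℕ} (hzi : finrank K z ≤ i)
    (hiy : i ≤ finrank K y) :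
    ∑ w ∈ grass K V i, (if z ≤ w ∧ w ≤ y then (1 : ℝ) else 0) =
      qBinom (Nat.card K) (finrank K y - finrank K z) (i - finrank K z) := by
  rw [sum_grass_ite_one _ fun w => z ≤ w ∧ w ≤ y, card_Icc z y hzy i hzi hiy]

lemma sum_grass_Ici (u : Submodule K V) {l : ℕ} (hl : l ≤ finrank K V) :
    ∑ y ∈ grass K V l, (if u ≤ y then (1 : ℝ) else 0) =
      if finrank K u ≤ l then qBinom (Nat.card K) (finrank K V - finrank K u) (l - finrank K u)
        else 0 := by
  split_ifs with h
  · have := sum_grass_Icc (le_top : u ≤ ⊤) h (by rwa [finrank_top])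
    simpa [finrank_top] using this
  · refine Finset.sum_eq_zero fun y hy => if_neg fun huy => h ?_
    rw [← mem_grass.1 hy]
    exact Submodule.finrank_mono huy

lemma sum_grass_Ici_disjoint {z x : Submodule K V} (hzx : z ⊓ x = ⊥) {l : ℕ}
    (h : finrank K x + l ≤ finrank K V) :
    ∑ y ∈ grass K V l, (if z ≤ y ∧ y ⊓ x = ⊥ then (1 : ℝ) else 0) =
      numDisjointAbove (Nat.card K) (finrank K V) (finrank K z) (finrank K x) l := by
  rw [numDisjointAbove]
  split_ifs with hj
  · have := card_above_inf_le z x l hj (by omega)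
    rw [hzx, finrank_bot, Nat.sub_zero] at this
    rw [← this, ← sum_grass_ite_one l fun y => z ≤ y ∧ y ⊓ x ≤ z]
    refine Finset.sum_congr rfl fun y _ => ?_
    refine if_congr (and_congr_right fun hzy => ⟨fun h => h ▸ bot_le, fun h => ?_⟩) rfl rfl
    rw [eq_bot_iff, ← hzx]
    exact le_inf h inf_le_right
  · refine Finset.sum_eq_zero fun y hy => if_neg fun huy => hj ?_
    rw [← mem_grass.1 hy]
    exact Submodule.finrank_mono huy.1

lemma sum_le_eq_sum_qBinom [Fintype (Submodule K V)] (η : ℕ → ℝ) (u : Submodule K V) :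
    ∑ v : Submodule K V, (if v ≤ u then η (finrank K v) else 0) =
      ∑ i ∈ Finset.range (finrank K u + 1), η i * qBinom (Nat.card K) (finrank K u) i := by
  have h1 (i : ℕ) (hi : i ∈ Finset.range (finrank K u + 1)) :
      η i * qBinom (Nat.card K) (finrank K u) i =
        ∑ v : Submodule K V, (if finrank K v = i then (if v ≤ u then η (finrank K v) else 0) else 0)
        := by
    have h2 := sum_grass_Icc (bot_le : ⊥ ≤ u) (i := i) (by simp)
      (Nat.lt_succ_iff.1 (Finset.mem_range.1 hi))
    simp only [finrank_bot, Nat.sub_zero, bot_le, true_and] at h2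
    rw [← h2, Finset.mul_sum, ← sum_grass_eq_sum_ite]
    refine Finset.sum_congr rfl fun v hv => ?_
    rw [mem_grass.1 hv]
    split_ifs <;> simp
  rw [Finset.sum_congr rfl h1, Finset.sum_comm]
  refine Finset.sum_congr rfl fun v _ => ?_
  rw [Finset.sum_ite_eq]
  split_ifs with h2 h3
  · rfl
  · exact absurd (Finset.mem_range.2 (Nat.lt_succ_iff.2 (Submodule.finrank_mono h2))) h3
  · rfl
  · rfl

/-- The system is triangular with unit diagonal, so the coefficients are found one at a time. -/
lemma exists_qBinom_inverse {q : ℝ} (hq : 1 < q) (h : ℕ → ℝ) (N : ℕ) :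
    ∃ η : ℕ → ℝ, ∀ m < N, h m = ∑ i ∈ Finset.range (m + 1), η i * qBinom q m i := by
  induction N with
  | zero => exact ⟨0, by simp⟩
  | succ N ih =>
    obtain ⟨η, hη⟩ := ih
    refine ⟨Function.update η N (h N - ∑ i ∈ Finset.range N, η i * qBinom q N i), fun m hm => ?_⟩
    rw [Finset.sum_range_succ]
    have h1 : ∑ i ∈ Finset.range m, Function.update η N
        (h N - ∑ i ∈ Finset.range N, η i * qBinom q N i) i * qBinom q m i =
        ∑ i ∈ Finset.range m, η i * qBinom q m i := by
      refine Finset.sum_congr rfl fun i hi => ?_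
      have := Finset.mem_range.1 hi
      rw [Function.update_of_ne (by omega)]
    rw [h1]
    rcases Nat.lt_succ_iff_lt_or_eq.1 hm with hlt | rfl
    · rw [Function.update_of_ne hlt.ne, ← Finset.sum_range_succ, ← hη m hlt]
    · have h2 : qBinom q m m = 1 := by
        refine Finset.prod_eq_one fun i hi => div_self ?_
        have := Finset.mem_range.1 hi
        exact (pow_sub_one_pos hq (by omega)).ne'
      rw [Function.update_self, h2]
      ring

/-- Expand `h (dim (z ⊓ x))` as a sum of `η (dim v)` over `v ≤ z ⊓ x` and exchange sums. Harmonicity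
kills every `v` of dimension below `j`, no `z` contains a `v` of dimension above `j`, and in
dimension `j` only `v = z` remains. Thus any kernel depending only on `dim (z ⊓ x)` acts on harmonic
functions through a single coefficient. -/
lemma IsHarmonic.sum_mul {j : ℕ} {φ : Submodule K V → ℝ} (hφ : IsHarmonic j φ) {h η : ℕ → ℝ}
    (hη : ∀ m ≤ finrank K V,
      h m = ∑ i ∈ Finset.range (m + 1), η i * qBinom (Nat.card K) m i) (x : Submodule K V) :
    ∑ z ∈ grass K V j, φ z * h (finrank K (z ⊓ x : Submodule K V)) = η j * upSum j φ x := by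
  have := Fintype.ofFinite (Submodule K V)
  have h1 (z : Submodule K V) : φ z * h (finrank K (z ⊓ x : Submodule K V)) =
      ∑ v : Submodule K V, if v ≤ x then η (finrank K v) * (if v ≤ z then φ z else 0) else 0 := by
    rw [hη _ (Submodule.finrank_le _), ← sum_le_eq_sum_qBinom, Finset.mul_sum]
    refine Finset.sum_congr rfl fun v _ => ?_
    rw [le_inf_iff]
    by_cases h1 : v ≤ z <;> by_cases h2 : v ≤ x <;> simp [h1, h2, mul_comm]
  rw [Finset.sum_congr rfl fun z _ => h1 z, Finset.sum_comm, upSum, Finset.mul_sum,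
    sum_grass_eq_sum_ite j fun v => η j * if v ≤ x then φ v else 0]
  refine Finset.sum_congr rfl fun v _ => ?_
  by_cases hvx : v ≤ x
  · simp only [if_pos hvx]
    rw [← Finset.mul_sum]
    rcases lt_trichotomy (finrank K v) j with hlt | heq | hgt
    · rw [hφ v hlt, mul_zero, if_neg hlt.ne]
    · rw [if_pos heq, heq, Finset.sum_eq_single v]
      · simp
      · intro z hz hzv
        refine if_neg fun hvz => hzv ?_
        exact (Submodule.eq_of_le_of_finrank_eq hvz (heq.trans (mem_grass.1 hz).symm)).symm
      · intro hv
        exact absurd (mem_grass.2 heq) hv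
    · rw [if_neg hgt.ne', Finset.sum_eq_zero, mul_zero]
      intro z hz
      refine if_neg fun hvz => ?_
      have := Submodule.finrank_mono hvz
      rw [mem_grass.1 hz] at this
      omega
  · simp [hvx]

lemma disjSum_upSum (j l : ℕ) (φ : Submodule K V → ℝ) (x : Submodule K V)
    (h : finrank K x + l ≤ finrank K V) :
    disjSum l (upSum j φ) x =
      numDisjointAbove (Nat.card K) (finrank K V) j (finrank K x) l * disjSum j φ x := by
  simp only [disjSum, upSum]
  have h1 (y : Submodule K V) : (if y ⊓ x = ⊥ then ∑ z ∈ grass K V j, (if z ≤ y then φ z else 0)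
      else 0) = ∑ z ∈ grass K V j, φ z * (if z ≤ y ∧ y ⊓ x = ⊥ then 1 else 0) := by
    by_cases hy : y ⊓ x = ⊥ <;> simp [hy]
  rw [Finset.sum_congr rfl fun y _ => h1 y, Finset.sum_comm, Finset.mul_sum]
  refine Finset.sum_congr rfl fun z hz => ?_
  rw [← Finset.mul_sum]
  split_ifs with hzx
  · rw [sum_grass_Ici_disjoint hzx h, mem_grass.1 hz, mul_comm]
  · rw [mul_zero, Finset.sum_eq_zero, mul_zero]
    rintro y -
    refine if_neg fun ⟨h1, h2⟩ => hzx ?_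
    rw [eq_bot_iff, ← h2]
    exact inf_le_inf_right _ h1

/-- Möbius inversion: the kernel is the indicator of `dim (z ⊓ x) = 0`, whose coefficients are the
values `qMoebius`. -/
lemma IsHarmonic.disjSum_eq {j : ℕ} {φ : Submodule K V → ℝ} (hφ : IsHarmonic j φ)
    (x : Submodule K V) : disjSum j φ x = qMoebius (Nat.card K) j * upSum j φ x := by
  rw [← hφ.sum_mul (h := fun m => if m = 0 then 1 else 0)
    (fun m _ => (sum_qMoebius_mul_qBinom (one_lt_card_cast K) m).symm), disjSum]
  refine Finset.sum_congr rfl fun z _ => ?_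
  simp [Submodule.finrank_eq_zero]

/-- Orthogonality of different degrees. The number of `l`-spaces containing `z ⊔ w` depends only on
`dim (z ⊓ w)`, so summing over `z` gives a multiple of `upSum j φ w`, which is zero because `dim w =
i < j`. -/
lemma IsHarmonic.sum_upSum_mul_upSum {i j l : ℕ} (hij : i < j) (hl : l ≤ finrank K V)
    {φ : Submodule K V → ℝ} (hφ : IsHarmonic j φ) (ψ : Submodule K V → ℝ) :
    ∑ y ∈ grass K V l, upSum i ψ y * upSum j φ y = 0 := by
  let h : ℕ → ℝ := fun m => if i + j - m ≤ l then
    qBinom (Nat.card K) (finrank K V - (i + j - m)) (l - (i + j - m)) else 0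
  obtain ⟨η, hη⟩ := exists_qBinom_inverse (one_lt_card_cast K) h (finrank K V + 1)
  have h1 (y : Submodule K V) : upSum i ψ y * upSum j φ y = ∑ w ∈ grass K V i, ∑ z ∈ grass K V j,
      ψ w * (φ z * if z ⊔ w ≤ y then 1 else 0) := by
    rw [upSum, upSum, Finset.sum_mul_sum]
    refine Finset.sum_congr rfl fun w _ => Finset.sum_congr rfl fun z _ => ?_
    rw [sup_le_iff]
    by_cases h1 : w ≤ y <;> by_cases h2 : z ≤ y <;> simp [h1, h2]
  rw [Finset.sum_congr rfl fun y _ => h1 y, Finset.sum_comm]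
  refine Finset.sum_eq_zero fun w hw => ?_
  rw [Finset.sum_comm]
  simp only [← Finset.mul_sum]
  have h2 (z : Submodule K V) (hz : z ∈ grass K V j) :
      φ z * ∑ y ∈ grass K V l, (if z ⊔ w ≤ y then (1 : ℝ) else 0) =
        φ z * h (finrank K (z ⊓ w : Submodule K V)) := by
    have := Submodule.finrank_sup_add_finrank_inf_eq z w
    rw [mem_grass.1 hz, mem_grass.1 hw] at this
    rw [sum_grass_Ici _ hl,
      show finrank K (z ⊔ w : Submodule K V) = i + j - finrank K (z ⊓ w : Submodule K V) by omega]
  rw [Finset.sum_congr rfl h2, hφ.sum_mul (fun m hm => hη m (Nat.lt_succ_iff.2 hm)), upSum,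
    Finset.sum_eq_zero, mul_zero, mul_zero]
  intro z hz
  refine if_neg fun hzw => ?_
  have := Submodule.finrank_mono hzw
  rw [mem_grass.1 hz, mem_grass.1 hw] at this
  omega

lemma upSum_upSum {i j : ℕ} (hji : j ≤ i) (φ : Submodule K V → ℝ) {y : Submodule K V}
    (hiy : i ≤ finrank K y) :
    upSum i (upSum j φ) y = qBinom (Nat.card K) (finrank K y - j) (i - j) * upSum j φ y := by
  simp only [upSum]
  have h1 (w : Submodule K V) : (if w ≤ y then ∑ z ∈ grass K V j, (if z ≤ w then φ z else 0)
      else 0) = ∑ z ∈ grass K V j, φ z * (if z ≤ w ∧ w ≤ y then 1 else 0) := by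
    by_cases hy : w ≤ y <;> simp [hy]
  rw [Finset.sum_congr rfl fun w _ => h1 w, Finset.sum_comm, Finset.mul_sum]
  refine Finset.sum_congr rfl fun z hz => ?_
  rw [← Finset.mul_sum]
  have hz' := mem_grass.1 hz
  split_ifs with hzy
  · rw [sum_grass_Icc hzy (by omega) hiy, hz', mul_comm]
  · rw [mul_zero, Finset.sum_eq_zero, mul_zero]
    rintro w -
    exact if_neg fun ⟨h1, h2⟩ => hzy (h1.trans h2)

/-- Least squares: `A` and `A * Aᵀ` have the same range, so the residual of `g` can be made
orthogonal to all rows of `A`. -/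
lemma exists_normal_equation_solution {α : Type*} [Fintype α] (A : Matrix α α ℝ) (g : α → ℝ) :
    ∃ φ : α → ℝ, ∀ a, ∑ b, A a b * (g b - ∑ a', A a' b * φ a') = 0 := by
  have h1 : (A * A.transpose).mulVecLin.range = A.mulVecLin.range := by
    refine Submodule.eq_of_le_of_finrank_eq ?_ (Matrix.rank_self_mul_transpose A)
    rw [Matrix.mulVecLin_mul]
    exact LinearMap.range_comp_le_range _ _
  have h2 : A.mulVec g ∈ (A * A.transpose).mulVecLin.range := by
    rw [h1]; exact ⟨g, rfl⟩
  obtain ⟨φ, hφ⟩ := h2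
  refine ⟨φ, fun a => ?_⟩
  have h3 := congrFun hφ a
  rw [Matrix.mulVecLin_apply, ← Matrix.mulVec_mulVec] at h3
  simp only [mul_sub, Finset.sum_sub_distrib]
  rw [sub_eq_zero]
  exact h3.symm

/-- Project `g` orthogonally onto the functions induced from dimensions below `l`. Orthogonality of
the residual to the indicators of `{y | w ≤ y}` is exactly harmonicity in degree `l`. The projection
is decomposed by induction, and `upSum_upSum` collects the contributions to each degree. -/
lemma exists_harmonic_decomposition (l : ℕ) (g : Submodule K V → ℝ) :
    ∃ φ : ℕ → Submodule K V → ℝ, (∀ j, IsHarmonic j (φ j)) ∧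
      ∀ y ∈ grass K V l, g y = ∑ j ∈ Finset.range (l + 1), upSum j (φ j) y := by
  induction l using Nat.strong_induction_on generalizing g with
  | _ l ih =>
    have := Fintype.ofFinite (Submodule K V)
    let A : Matrix (Submodule K V) (Submodule K V) ℝ := fun w y =>
      if finrank K y = l ∧ finrank K w < l ∧ w ≤ y then 1 else 0
    obtain ⟨ψ, hψ⟩ := exists_normal_equation_solution A g
    have hih (i : ℕ) : ∃ φ : ℕ → Submodule K V → ℝ, (∀ j, IsHarmonic j (φ j)) ∧
        (i < l → ∀ y ∈ grass K V i, ψ y = ∑ j ∈ Finset.range (i + 1), upSum j (φ j) y) := by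
      by_cases hi : i < l
      · obtain ⟨φ, h1, h2⟩ := ih i hi ψ
        exact ⟨φ, h1, fun _ => h2⟩
      · exact ⟨0, fun j w _ => by simp, fun h => absurd h hi⟩
    choose φ hφ hφ2 using hih
    let top : Submodule K V → ℝ := fun y => g y - ∑ w, A w y * ψ w
    have htop : IsHarmonic l top := by
      intro w hw
      refine Eq.trans ?_ (hψ w)
      rw [sum_grass_eq_sum_ite]
      refine Finset.sum_congr rfl fun y _ => ?_
      by_cases h1 : finrank K y = l <;> by_cases h2 : w ≤ y <;> simp [A, top, h1, h2, hw]
    let φ' : ℕ → Submodule K V → ℝ := fun j => if j = l then top else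
      fun z => ∑ i ∈ (Finset.range l).filter (j ≤ ·), qBinom (Nat.card K) (l - j) (i - j) * φ i j z
    have hφ' (j : ℕ) (hj : j < l) : φ' j = fun z => ∑ i ∈ (Finset.range l).filter (j ≤ ·),
        qBinom (Nat.card K) (l - j) (i - j) * φ i j z := if_neg hj.ne
    refine ⟨φ', fun j => ?_, fun y hy => ?_⟩
    · by_cases hj : j = l
      · subst hj
        simpa [φ'] using htop
      · simp only [φ', if_neg hj]
        exact isHarmonic_sum_mul _ _ _ _ fun i _ => hφ i j
    · have hyl := mem_grass.1 hy
      have htopy : upSum l (φ' l) y = top y := by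
        simp only [φ', if_true, upSum]
        rw [Finset.sum_eq_single y]
        · simp
        · intro z hz hzy
          refine if_neg fun hle => hzy ?_
          exact Submodule.eq_of_le_of_finrank_eq hle ((mem_grass.1 hz).trans hyl.symm)
        · intro h
          exact absurd hy h
      rw [Finset.sum_range_succ, htopy]
      suffices h : ∑ w, A w y * ψ w = ∑ j ∈ Finset.range l, upSum j (φ' j) y by
        rw [← h]; simp only [top]; ring
      have h1 : ∑ w, A w y * ψ w = ∑ i ∈ Finset.range l, upSum i ψ y := by
        simp only [upSum]
        rw [Finset.sum_congr rfl fun i _ => sum_grass_eq_sum_ite i _, Finset.sum_comm]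
        refine Finset.sum_congr rfl fun w _ => ?_
        rw [Finset.sum_ite_eq]
        by_cases h3 : finrank K w < l <;> by_cases h4 : w ≤ y <;>
          simp [A, h3, h4, hyl]
      rw [h1]
      have h2 (i : ℕ) (hi : i ∈ Finset.range l) : upSum i ψ y = ∑ j ∈ Finset.range l,
          if j ≤ i then qBinom (Nat.card K) (l - j) (i - j) * upSum j (φ i j) y else 0 := by
        have hil := Finset.mem_range.1 hi
        have h3 : upSum i ψ y =
            upSum i (fun z => ∑ j ∈ Finset.range (i + 1), 1 * upSum j (φ i j) z) y := by
          refine Finset.sum_congr rfl fun z hz => ?_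
          rw [hφ2 i hil z hz]
          simp
        rw [h3, upSum_sum_mul, ← Finset.sum_filter]
        refine Finset.sum_congr ?_ fun j hj => ?_
        · ext j
          simp only [Finset.mem_range, Finset.mem_filter]
          omega
        · have := (Finset.mem_filter.1 hj).2
          rw [one_mul, upSum_upSum this _ (by omega), hyl]
      rw [Finset.sum_congr rfl h2, Finset.sum_comm]
      refine Finset.sum_congr rfl fun j hj => ?_
      rw [hφ' j (Finset.mem_range.1 hj), upSum_sum_mul, Finset.sum_filter]

end Harmonic

/-! ### The quadratic form and its diagonalization. -/

section Bound

open scoped Classical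

variable {K V : Type*} [Field K] [AddCommGroup V] [Module K V] [Finite V]

lemma disjSum_congr {l : ℕ} {g g' : Submodule K V → ℝ} (h : ∀ y ∈ grass K V l, g y = g' y)
    (x : Submodule K V) : disjSum l g x = disjSum l g' x :=
  Finset.sum_congr rfl fun y hy => by rw [h y hy]

/-- `disjSum` as a linear map. -/
noncomputable def disjLin (K V : Type*) [Field K] [AddCommGroup V] [Module K V] [Finite V]
    (l : ℕ) : (Submodule K V → ℝ) →ₗ[ℝ] (Submodule K V → ℝ) where
  toFun := disjSum l
  map_add' g g' := by
    funext x
    simp only [disjSum, Pi.add_apply]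
    rw [← Finset.sum_add_distrib]
    exact Finset.sum_congr rfl fun y _ => by split_ifs <;> simp
  map_smul' c g := by
    funext x
    simp only [disjSum, Pi.smul_apply, smul_eq_mul, RingHom.id_apply]
    rw [Finset.mul_sum]
    exact Finset.sum_congr rfl fun y _ => by split_ifs <;> simp

/-- The total of a function over the `l`-dimensional subspaces, as a constant function. -/
noncomputable def totalLin (K V : Type*) [Field K] [AddCommGroup V] [Module K V] [Finite V]
    (l : ℕ) : (Submodule K V → ℝ) →ₗ[ℝ] (Submodule K V → ℝ) where
  toFun g _ := ∑ y ∈ grass K V l, g y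
  map_add' g g' := by
    funext x
    simp [Finset.sum_add_distrib]
  map_smul' c g := by
    funext x
    simp [Finset.mul_sum]

lemma sum_mul_disjSum_comm (k l : ℕ) (f g : Submodule K V → ℝ) :
    ∑ x ∈ grass K V k, f x * disjSum l g x = ∑ y ∈ grass K V l, g y * disjSum k f y := by
  simp only [disjSum, Finset.mul_sum]
  rw [Finset.sum_comm]
  refine Finset.sum_congr rfl fun y _ => Finset.sum_congr rfl fun x _ => ?_
  rw [inf_comm]
  split_ifs <;> ring

lemma finrank_eq_one_inf_eq_bot_iff {z x : Submodule K V} (hz : finrank K z = 1) :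
    z ⊓ x = ⊥ ↔ ¬ z ≤ x := by
  constructor
  · intro h hle
    rw [inf_eq_left.2 hle] at h
    rw [h, finrank_bot] at hz
    omega
  · intro h
    rw [← Submodule.finrank_eq_zero (R := K)]
    by_contra h0
    have h1 := Submodule.finrank_mono (inf_le_left : z ⊓ x ≤ z)
    have h2 := Submodule.eq_of_le_of_finrank_eq (inf_le_left : z ⊓ x ≤ z) (by omega)
    exact h (inf_eq_left.1 h2)

lemma disjSum_one (φ : Submodule K V → ℝ) (x : Submodule K V) :
    disjSum 1 φ x = ∑ z ∈ grass K V 1, φ z - upSum 1 φ x := by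
  rw [disjSum, upSum, ← Finset.sum_sub_distrib]
  refine Finset.sum_congr rfl fun z hz => ?_
  simp only [finrank_eq_one_inf_eq_bot_iff (mem_grass.1 hz)]
  by_cases h : z ≤ x <;> simp [h]

variable [Finite K]

lemma sum_upSum {j l : ℕ} (hjl : j ≤ l) (hl : l ≤ finrank K V) (φ : Submodule K V → ℝ) :
    ∑ y ∈ grass K V l, upSum j φ y =
      qBinom (Nat.card K) (finrank K V - j) (l - j) * ∑ z ∈ grass K V j, φ z := by
  have h (m : ℕ) (ψ : Submodule K V → ℝ) : ∑ y ∈ grass K V m, ψ y = upSum m ψ ⊤ := by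
    simp [upSum]
  rw [h, h, upSum_upSum hjl φ (by rwa [finrank_top]), finrank_top]

lemma IsHarmonic.sum_upSum_eq_zero {j l : ℕ} (hj : 1 ≤ j) (hl : l ≤ finrank K V)
    {φ : Submodule K V → ℝ} (hφ : IsHarmonic j φ) : ∑ y ∈ grass K V l, upSum j φ y = 0 := by
  by_cases hjl : j ≤ l
  · have := hφ ⊥ (by rw [finrank_bot]; omega)
    simp only [bot_le, if_true] at this
    rw [sum_upSum hjl hl, this, mul_zero]
  · refine Finset.sum_eq_zero fun y hy => Finset.sum_eq_zero fun z hz => if_neg fun hzy => hjl ?_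
    rw [← mem_grass.1 hy, ← mem_grass.1 hz]
    exact Submodule.finrank_mono hzy

/-- Degrees 0 and 1 are merged because the certificate degenerates on both. The degree 0 part is
constant, so it is the sum over points of a constant divided by `c`, the number of points of an
`l`-space. -/
lemma exists_decomposition_one {l : ℕ} (hl : 1 ≤ l) (g : Submodule K V → ℝ) :
    ∃ (φ₁ : Submodule K V → ℝ) (φ : ℕ → Submodule K V → ℝ), (∀ j, IsHarmonic j (φ j)) ∧
      ∀ y ∈ grass K V l,
        g y = (upSum 1 φ₁ + ∑ i ∈ Finset.range (l - 1), upSum (i + 2) (φ (i + 2))) y := by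
  obtain ⟨φ, hφ, h⟩ := exists_harmonic_decomposition l g
  let c := qBinom (Nat.card K) l 1
  have hc : c ≠ 0 := (qBinom_pos (one_lt_card_cast K) hl).ne'
  refine ⟨fun z => ∑ i ∈ Finset.range 2, (if i = 0 then c⁻¹ else 1) *
    (if i = 0 then upSum 0 (φ 0) else φ 1) z, φ, hφ, fun y hy => ?_⟩
  rw [h y hy, Pi.add_apply, upSum_sum_mul, Finset.sum_apply]
  simp only [Finset.sum_range_succ, Finset.sum_range_zero, if_true, one_ne_zero, if_false]
  rw [upSum_upSum (Nat.zero_le 1) _ (by rw [mem_grass.1 hy]; exact hl), mem_grass.1 hy]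
  obtain ⟨l, rfl⟩ := Nat.exists_eq_add_of_le' hl
  rw [← Finset.sum_range_succ, Finset.sum_range_succ', Finset.sum_range_succ']
  simp only [Nat.sub_zero, Nat.add_sub_cancel, zero_add, one_mul]
  rw [← mul_assoc, inv_mul_cancel₀ hc, one_mul]
  ring

/-- The quadratic form certificate: nonnegativity and its zeros. -/
lemma quadratic_certificate {k l : ℕ} (hk : 1 ≤ k) (hkl : k ≤ l) (hn : 2 * l ≤ finrank K V)
    {A B γ t : ℝ} (hB : 0 < B)
    (hγ : γ * numDisjointAbove (Nat.card K) (finrank K V) 1 k l = B)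
    (ht : γ * numDisjointAbove (Nat.card K) (finrank K V) 1 l k -
      t * numDisjointAbove (Nat.card K) (finrank K V) 1 l l = A)
    (hA' : A = qBinom (Nat.card K) (finrank K V - 1) (k - 1))
    (hB' : B = qBinom (Nat.card K) (finrank K V - 1) (l - 1))
    (hpos : ∀ j, 2 ≤ j → j ≤ l →
      0 < A - t * (qMoebius (Nat.card K) j *
          numDisjointAbove (Nat.card K) (finrank K V) j l l) -
        γ ^ 2 * (qMoebius (Nat.card K) j ^ 2 *
          (numDisjointAbove (Nat.card K) (finrank K V) j k l *
            numDisjointAbove (Nat.card K) (finrank K V) j l k)) / B)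
    (f g : Submodule K V → ℝ) {Q : ℝ}
    (hQ : Q = B * ∑ x ∈ grass K V k, f x ^ 2 + A * ∑ y ∈ grass K V l, g y ^ 2 -
      2 * ((∑ x ∈ grass K V k, f x) * ∑ y ∈ grass K V l, g y) +
      2 * γ * ∑ x ∈ grass K V k, f x * disjSum l g x -
      t * ∑ y ∈ grass K V l, g y * disjSum l g y) :
    0 ≤ Q ∧ (Q = 0 → ∃ φ : Submodule K V → ℝ, (∀ x ∈ grass K V k, f x = upSum 1 φ x) ∧
      ∀ y ∈ grass K V l, g y = upSum 1 φ y) := by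
  obtain ⟨φ₁, φ, hφ, hg⟩ := exists_decomposition_one (hk.trans hkl) g
  set u : ℕ → Submodule K V → ℝ := fun i => upSum (i + 2) (φ (i + 2)) with hu
  set g' : Submodule K V → ℝ := upSum 1 φ₁ + ∑ i ∈ Finset.range (l - 1), u i with hg'
  -- The cross terms of `Q` combine to `2⟨f, P l g⟩`; the maps `P l` and `P k` are mutually adjoint.
  let P : ℕ → (Submodule K V → ℝ) →ₗ[ℝ] (Submodule K V → ℝ) := fun m =>
    γ • disjLin K V m - totalLin K V m
  have hP (m : ℕ) (h : Submodule K V → ℝ) (x : Submodule K V) :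
      P m h x = γ * disjSum m h x - ∑ y ∈ grass K V m, h y := rfl
  have hPcongr (m : ℕ) {h h' : Submodule K V → ℝ} (hh : ∀ y ∈ grass K V m, h y = h' y)
      (x : Submodule K V) : P m h x = P m h' x := by
    rw [hP, hP, disjSum_congr hh, Finset.sum_congr rfl hh]
  have hadj (h h' : Submodule K V → ℝ) : ∑ x ∈ grass K V k, h x * P l h' x =
      ∑ y ∈ grass K V l, h' y * P k h y := by
    simp only [hP, mul_sub, Finset.sum_sub_distrib, ← Finset.sum_mul, mul_left_comm _ γ,
      ← Finset.mul_sum]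
    rw [sum_mul_disjSum_comm]
    ring
  -- The Schur complement: `⟨g, M g⟩` is what remains of `Q` after completing the square in `f`.
  let M : (Submodule K V → ℝ) →ₗ[ℝ] (Submodule K V → ℝ) :=
    A • LinearMap.id - t • disjLin K V l - B⁻¹ • (P k ∘ₗ P l)
  have hM (h : Submodule K V → ℝ) (y : Submodule K V) :
      M h y = A * h y - t * disjSum l h y - B⁻¹ * P k (P l h) y := rfl
  -- the action on functions of degree one
  have hP1 (ψ : Submodule K V → ℝ) (x : Submodule K V) (hx : x ∈ grass K V k) :
      P l (upSum 1 ψ) x = -(B * upSum 1 ψ x) := by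
    have hx' := mem_grass.1 hx
    rw [hP, disjSum_upSum _ _ _ _ (by omega), sum_upSum (by omega) (by omega), ← hB', disjSum_one,
      hx', ← mul_assoc, hγ]
    ring
  have hM1 (ψ : Submodule K V → ℝ) (y : Submodule K V) (hy : y ∈ grass K V l) :
      M (upSum 1 ψ) y = 0 := by
    have hy' := mem_grass.1 hy
    have h1 : P k (P l (upSum 1 ψ)) y = -B * P k (upSum 1 ψ) y := by
      rw [hPcongr k (h' := (-B) • upSum 1 ψ) (fun x hx => by
        rw [hP1 ψ x hx, Pi.smul_apply, smul_eq_mul, neg_mul]) y, map_smul, Pi.smul_apply,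
        smul_eq_mul]
    rw [hM, h1, hP, disjSum_upSum _ _ _ _ (by omega), disjSum_upSum _ _ _ _ (by omega),
      sum_upSum (by omega) (by omega), ← hA', disjSum_one, hy', neg_mul, mul_neg,
      inv_mul_cancel_left₀ hB.ne']
    linear_combination (∑ z ∈ grass K V 1, ψ z - upSum 1 ψ y) * ht
  -- the action on harmonic functions
  have hPj {j m r : ℕ} (hj : 1 ≤ j) {ψ : Submodule K V → ℝ} (hψ : IsHarmonic j ψ)
      (hmr : r + m ≤ finrank K V) (x : Submodule K V) (hx : x ∈ grass K V r) :
      P m (upSum j ψ) x = (γ * numDisjointAbove (Nat.card K) (finrank K V) j r m *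
        qMoebius (Nat.card K) j) * upSum j ψ x := by
    have hx' := mem_grass.1 hx
    rw [hP, disjSum_upSum _ _ _ _ (by omega), hψ.sum_upSum_eq_zero hj (by omega), hψ.disjSum_eq,
      hx']
    ring
  let τ : ℕ → ℝ := fun j => A - t * (qMoebius (Nat.card K) j *
          numDisjointAbove (Nat.card K) (finrank K V) j l l) -
        γ ^ 2 * (qMoebius (Nat.card K) j ^ 2 *
          (numDisjointAbove (Nat.card K) (finrank K V) j k l *
            numDisjointAbove (Nat.card K) (finrank K V) j l k)) / B
  have hMj {j : ℕ} (hj : 1 ≤ j) {ψ : Submodule K V → ℝ} (hψ : IsHarmonic j ψ)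
      (y : Submodule K V) (hy : y ∈ grass K V l) : M (upSum j ψ) y = τ j * upSum j ψ y := by
    have hy' := mem_grass.1 hy
    have h1 : P k (P l (upSum j ψ)) y =
        (γ * numDisjointAbove (Nat.card K) (finrank K V) j k l * qMoebius (Nat.card K) j) *
          P k (upSum j ψ) y := by
      rw [hPcongr k (h' := (γ * numDisjointAbove (Nat.card K) (finrank K V) j k l *
        qMoebius (Nat.card K) j) • upSum j ψ) (fun x hx => by
        rw [hPj hj hψ (by omega) x hx, Pi.smul_apply, smul_eq_mul]) y, map_smul, Pi.smul_apply,
        smul_eq_mul]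
    rw [hM, h1, hPj hj hψ (by omega) y hy, disjSum_upSum _ _ _ _ (by omega), hψ.disjSum_eq, hy']
    simp only [τ]
    ring
  have hMg (y : Submodule K V) (hy : y ∈ grass K V l) :
      M g' y = ∑ i ∈ Finset.range (l - 1), τ (i + 2) * u i y := by
    rw [hg', map_add, Pi.add_apply, hM1 _ y hy, zero_add, map_sum, Finset.sum_apply]
    exact Finset.sum_congr rfl fun i _ => hMj (by omega) (hφ _) y hy
  -- orthogonality
  have horth (i : ℕ) (hi : i ∈ Finset.range (l - 1)) :
      ∑ y ∈ grass K V l, g' y * u i y = ∑ y ∈ grass K V l, u i y ^ 2 := by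
    simp only [hg', Pi.add_apply, Finset.sum_apply, add_mul, Finset.sum_add_distrib,
      Finset.sum_mul]
    rw [(hφ (i + 2)).sum_upSum_mul_upSum (by omega) (by omega), zero_add, Finset.sum_comm,
      Finset.sum_eq_single i]
    · simp only [sq]
    · intro j _ hji
      rcases lt_or_gt_of_ne hji with h | h
      · exact (hφ (i + 2)).sum_upSum_mul_upSum (by omega) (by omega) _
      · simp only [mul_comm (u j _)]
        exact (hφ (j + 2)).sum_upSum_mul_upSum (by omega) (by omega) _
    · exact fun h => absurd hi h
  have hform : ∑ y ∈ grass K V l, g' y * M g' y =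
      ∑ i ∈ Finset.range (l - 1), τ (i + 2) * ∑ y ∈ grass K V l, u i y ^ 2 := by
    rw [Finset.sum_congr rfl fun y hy => by rw [hMg y hy, Finset.mul_sum], Finset.sum_comm]
    refine Finset.sum_congr rfl fun i hi => ?_
    rw [← horth i hi, Finset.mul_sum]
    exact Finset.sum_congr rfl fun y _ => by ring
  have hQ' : Q = B * ∑ x ∈ grass K V k, (f x + B⁻¹ * P l g' x) ^ 2 +
      ∑ i ∈ Finset.range (l - 1), τ (i + 2) * ∑ y ∈ grass K V l, u i y ^ 2 := by
    have e1 : ∑ x ∈ grass K V k, (f x + B⁻¹ * P l g' x) ^ 2 = ∑ x ∈ grass K V k, f x ^ 2 +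
        2 * B⁻¹ * ∑ x ∈ grass K V k, f x * P l g' x +
        B⁻¹ ^ 2 * ∑ x ∈ grass K V k, P l g' x * P l g' x := by
      rw [Finset.mul_sum, Finset.mul_sum, ← Finset.sum_add_distrib, ← Finset.sum_add_distrib]
      exact Finset.sum_congr rfl fun x _ => by ring
    have e2 : ∑ y ∈ grass K V l, g' y * M g' y = A * ∑ y ∈ grass K V l, g' y ^ 2 -
        t * ∑ y ∈ grass K V l, g' y * disjSum l g' y -
        B⁻¹ * ∑ y ∈ grass K V l, g' y * P k (P l g') y := by
      rw [Finset.mul_sum, Finset.mul_sum, Finset.mul_sum, ← Finset.sum_sub_distrib,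
        ← Finset.sum_sub_distrib]
      exact Finset.sum_congr rfl fun x _ => by rw [hM]; ring
    have e3 : ∑ x ∈ grass K V k, f x * P l g' x = γ * ∑ x ∈ grass K V k, f x * disjSum l g' x -
        (∑ x ∈ grass K V k, f x) * ∑ y ∈ grass K V l, g' y := by
      rw [Finset.mul_sum, Finset.sum_mul, ← Finset.sum_sub_distrib]
      exact Finset.sum_congr rfl fun x _ => by rw [hP]; ring
    have c1 : ∑ y ∈ grass K V l, g y ^ 2 = ∑ y ∈ grass K V l, g' y ^ 2 :=
      Finset.sum_congr rfl fun y hy => by rw [hg y hy]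
    have c2 : ∑ x ∈ grass K V k, f x * disjSum l g x = ∑ x ∈ grass K V k, f x * disjSum l g' x :=
      Finset.sum_congr rfl fun x _ => by rw [disjSum_congr hg]
    have c3 : ∑ y ∈ grass K V l, g y * disjSum l g y = ∑ y ∈ grass K V l, g' y * disjSum l g' y :=
      Finset.sum_congr rfl fun y hy => by rw [hg y hy, disjSum_congr hg]
    rw [← hform, e1, e2, hadj (P l g') g', e3, hQ, c1, c2, c3, Finset.sum_congr rfl hg]
    field_simp
    ring
  have hτ (i : ℕ) (hi : i ∈ Finset.range (l - 1)) : 0 < τ (i + 2) := by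
    have := Finset.mem_range.1 hi
    exact hpos _ (by omega) (by omega)
  have hn1 : 0 ≤ ∑ x ∈ grass K V k, (f x + B⁻¹ * P l g' x) ^ 2 :=
    Finset.sum_nonneg fun _ _ => sq_nonneg _
  have hn2 (i : ℕ) : 0 ≤ ∑ y ∈ grass K V l, u i y ^ 2 :=
    Finset.sum_nonneg fun _ _ => sq_nonneg _
  have hn3 : 0 ≤ ∑ i ∈ Finset.range (l - 1), τ (i + 2) * ∑ y ∈ grass K V l, u i y ^ 2 :=
    Finset.sum_nonneg fun i hi => mul_nonneg (hτ i hi).le (hn2 i)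
  refine ⟨by rw [hQ']; positivity, fun h0 => ?_⟩
  rw [hQ'] at h0
  have z1 : ∑ x ∈ grass K V k, (f x + B⁻¹ * P l g' x) ^ 2 = 0 := by nlinarith
  have z2 : ∑ i ∈ Finset.range (l - 1), τ (i + 2) * ∑ y ∈ grass K V l, u i y ^ 2 = 0 := by
    nlinarith
  rw [Finset.sum_eq_zero_iff_of_nonneg fun _ _ => sq_nonneg _] at z1
  rw [Finset.sum_eq_zero_iff_of_nonneg fun i hi => mul_nonneg (hτ i hi).le (hn2 i)] at z2
  have hgφ (y : Submodule K V) (hy : y ∈ grass K V l) : g' y = upSum 1 φ₁ y := by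
    rw [hg', Pi.add_apply, Finset.sum_apply, Finset.sum_eq_zero, add_zero]
    intro i hi
    have h1 := (mul_eq_zero.1 (z2 i hi)).resolve_left (hτ i hi).ne'
    rw [Finset.sum_eq_zero_iff_of_nonneg fun _ _ => sq_nonneg _] at h1
    exact pow_eq_zero_iff two_ne_zero |>.1 (h1 y hy)
  -- The square vanishes, so `f = -B⁻¹ P l g`. Since `P l` acts as `-B` on degree one, `f` is
  -- induced by the same `φ₁` as `g`.
  refine ⟨φ₁, fun x hx => ?_, fun y hy => (hg y hy).trans (hgφ y hy)⟩
  have h1 := pow_eq_zero_iff two_ne_zero |>.1 (z1 x hx)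
  rw [hPcongr l hgφ, hP1 φ₁ x hx, mul_neg, inv_mul_cancel_left₀ hB.ne'] at h1
  linarith

end Bound

/-! ### The product bound. -/

section CrossBound

open scoped Classical

variable {K V : Type*} [Field K] [AddCommGroup V] [Module K V] [Finite V]

lemma sum_grass_ite_mem {k : ℕ} {F : Set (Submodule K V)} (hF : F ⊆ subspacesOfDim K V k)
    (c : ℝ) : ∑ x ∈ grass K V k, (if x ∈ F then c else 0) = F.ncard * c := by
  rw [← Finset.sum_filter, Finset.sum_const, nsmul_eq_mul, Set.ncard_eq_toFinset_card _ F.toFinite]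
  congr 3
  ext x
  rw [Finset.mem_filter, mem_grass, Set.Finite.mem_toFinset]
  exact ⟨fun h => h.2, fun h => ⟨hF h, h⟩⟩

variable [Finite K]

lemma two_le_card_cast (K : Type*) [Field K] [Finite K] : (2 : ℝ) ≤ Nat.card K := by
  exact_mod_cast Finite.one_lt_card (α := K)

lemma crossIntersecting_bound_of_le {k l : ℕ} (hk : 1 ≤ k) (hkl : k ≤ l)
    (hn : 2 * l ≤ finrank K V) {F G : Set (Submodule K V)} (hF : F ⊆ subspacesOfDim K V k)
    (hG : G ⊆ subspacesOfDim K V l) (hFG : CrossIntersecting F G) :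
    (F.ncard : ℝ) * G.ncard ≤ qBinom (Nat.card K) (finrank K V - 1) (k - 1) *
        qBinom (Nat.card K) (finrank K V - 1) (l - 1) ∧
      ((F.ncard : ℝ) * G.ncard = qBinom (Nat.card K) (finrank K V - 1) (k - 1) *
          qBinom (Nat.card K) (finrank K V - 1) (l - 1) →
        ∃ (φ : Submodule K V → ℝ) (s : ℝ), 0 < s ∧
          (∀ x ∈ grass K V k, upSum 1 φ x = if x ∈ F then s else 0) ∧
          ∀ y ∈ grass K V l, upSum 1 φ y = if y ∈ G then s⁻¹ else 0) := by
  obtain ⟨γ, t, -, ht0, hγ, ht, hpos⟩ := exists_multipliers (two_le_card_cast K) hk hkl hn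
  have hA : 0 < qBinom (Nat.card K : ℝ) (finrank K V - 1) (k - 1) :=
    qBinom_pos (one_lt_card_cast K) (by omega)
  have hB : 0 < qBinom (Nat.card K : ℝ) (finrank K V - 1) (l - 1) :=
    qBinom_pos (one_lt_card_cast K) (by omega)
  have hcert := quadratic_certificate hk hkl hn hB hγ ht rfl rfl hpos
  generalize qBinom (Nat.card K : ℝ) (finrank K V - 1) (k - 1) = A at *
  generalize qBinom (Nat.card K : ℝ) (finrank K V - 1) (l - 1) = B at *
  rcases (Nat.zero_le F.ncard).eq_or_lt with hF0 | hF0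
  · rw [← hF0, Nat.cast_zero, zero_mul]
    exact ⟨by positivity, fun h => absurd h (by positivity)⟩
  rcases (Nat.zero_le G.ncard).eq_or_lt with hG0 | hG0
  · rw [← hG0, Nat.cast_zero, mul_zero]
    exact ⟨by positivity, fun h => absurd h (by positivity)⟩
  have ha : (0 : ℝ) < F.ncard := by exact_mod_cast hF0
  have hb : (0 : ℝ) < G.ncard := by exact_mod_cast hG0
  generalize hadef : (F.ncard : ℝ) = a at *
  generalize hbdef : (G.ncard : ℝ) = b at *
  -- This `s` equalizes `B a s²` and `A b s⁻²`; their common value squared is `(A B)(a b)`.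
  let s : ℝ := √(√(A * b / (B * a)))
  have hs : 0 < s := Real.sqrt_pos.2 (Real.sqrt_pos.2 (by positivity))
  have hs4 : (s ^ 2) ^ 2 * (B * a) = A * b := by
    rw [Real.sq_sqrt (Real.sqrt_nonneg _), Real.sq_sqrt (by positivity),
      div_mul_cancel₀ _ (by positivity)]
  let f : Submodule K V → ℝ := fun x => if x ∈ F then s else 0
  let g : Submodule K V → ℝ := fun y => if y ∈ G then s⁻¹ else 0
  have hf2 : ∑ x ∈ grass K V k, f x ^ 2 = a * s ^ 2 := by
    rw [← hadef, ← sum_grass_ite_mem hF]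
    exact Finset.sum_congr rfl fun x _ => by simp [f]
  have hg2 : ∑ y ∈ grass K V l, g y ^ 2 = b * s⁻¹ ^ 2 := by
    rw [← hbdef, ← sum_grass_ite_mem hG]
    exact Finset.sum_congr rfl fun x _ => by simp [g]
  have hf1 : ∑ x ∈ grass K V k, f x = a * s := hadef ▸ sum_grass_ite_mem hF s
  have hg1 : ∑ y ∈ grass K V l, g y = b * s⁻¹ := hbdef ▸ sum_grass_ite_mem hG s⁻¹
  have hfg : ∑ x ∈ grass K V k, f x * disjSum l g x = 0 := by
    refine Finset.sum_eq_zero fun x _ => ?_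
    by_cases hx : x ∈ F
    · rw [disjSum, Finset.sum_eq_zero, mul_zero]
      intro y _
      by_cases hy : y ∈ G
      · rw [if_neg]
        rw [inf_comm]
        exact hFG x hx y hy
      · simp [g, hy]
    · simp [f, hx]
  have hgg : 0 ≤ ∑ y ∈ grass K V l, g y * disjSum l g y := by
    have hg0 (y : Submodule K V) : 0 ≤ g y := by
      simp only [g]
      split_ifs
      · exact (inv_pos.2 hs).le
      · exact le_rfl
    refine Finset.sum_nonneg fun y _ => mul_nonneg (hg0 y) (Finset.sum_nonneg fun z _ => ?_)
    split_ifs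
    · exact hg0 z
    · exact le_rfl
  obtain ⟨hQ0, hQ1⟩ := hcert f g rfl
  rw [hf2, hg2, hf1, hg1, hfg, mul_zero, add_zero,
    show a * s * (b * s⁻¹) = a * b by field_simp] at hQ0 hQ1
  have hbal : A * (b * s⁻¹ ^ 2) = B * (a * s ^ 2) := by
    field_simp
    linear_combination -hs4
  have hsq : (B * (a * s ^ 2)) ^ 2 = (A * B) * (a * b) := by
    linear_combination B * a * hs4
  have htg := mul_nonneg ht0 hgg
  have hle : a * b ≤ B * (a * s ^ 2) := by
    rw [hbal] at hQ0
    linarith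
  have hab : 0 < a * b := by positivity
  have hsqle : (a * b) * (a * b) ≤ (A * B) * (a * b) := by
    rw [← hsq, sq]
    exact mul_self_le_mul_self hab.le hle
  refine ⟨le_of_mul_le_mul_right hsqle hab, fun heq => ?_⟩
  have h1 : B * (a * s ^ 2) = a * b := by
    rw [← heq, ← sq] at hsq
    exact (pow_left_inj₀ (by positivity) hab.le two_ne_zero).1 hsq
  have h2 := hQ1 (le_antisymm (by rw [hbal, h1]; linarith) hQ0)
  obtain ⟨φ, h3, h4⟩ := h2
  exact ⟨φ, s, hs, fun x hx => (h3 x hx).symm, fun y hy => (h4 y hy).symm⟩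

lemma crossIntersecting_bound {k l : ℕ} (hk : 1 ≤ k) (hl : 1 ≤ l) (hnk : 2 * k ≤ finrank K V)
    (hnl : 2 * l ≤ finrank K V) {F G : Set (Submodule K V)} (hF : F ⊆ subspacesOfDim K V k)
    (hG : G ⊆ subspacesOfDim K V l) (hFG : CrossIntersecting F G) :
    (F.ncard : ℝ) * G.ncard ≤ qBinom (Nat.card K) (finrank K V - 1) (k - 1) *
        qBinom (Nat.card K) (finrank K V - 1) (l - 1) ∧
      ((F.ncard : ℝ) * G.ncard = qBinom (Nat.card K) (finrank K V - 1) (k - 1) *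
          qBinom (Nat.card K) (finrank K V - 1) (l - 1) →
        ∃ (φ : Submodule K V → ℝ) (s : ℝ), 0 < s ∧
          (∀ x ∈ grass K V k, upSum 1 φ x = if x ∈ F then s else 0) ∧
          ∀ y ∈ grass K V l, upSum 1 φ y = if y ∈ G then s⁻¹ else 0) := by
  rcases le_total k l with hkl | hlk
  · exact crossIntersecting_bound_of_le hk hkl hnl hF hG hFG
  · obtain ⟨h1, h2⟩ := crossIntersecting_bound_of_le hl hlk hnk hG hF
      (fun x hx y hy => by rw [inf_comm]; exact hFG y hy x hx)
    rw [mul_comm (G.ncard : ℝ), mul_comm (qBinom _ _ (l - 1))] at h1 h2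
    refine ⟨h1, fun h => ?_⟩
    obtain ⟨φ, s, hs, hφG, hφF⟩ := h2 h
    exact ⟨φ, s⁻¹, inv_pos.2 hs, hφF, fun y hy => by rw [hφG y hy, inv_inv]⟩

end CrossBound

/-! ### Point functions with many vanishing or equal sums. -/

section Structure

open scoped Classical

lemma qBinom_one_right (q : ℝ) (m : ℕ) : qBinom q m 1 = (q ^ m - 1) / (q - 1) := by
  simp [qBinom]

variable {K V : Type*} [Field K] [AddCommGroup V] [Module K V]

lemma exists_point_not_le {x y : Submodule K V} (h : ¬ y ≤ x) :
    ∃ p : Submodule K V, finrank K p = 1 ∧ p ≤ y ∧ ¬ p ≤ x := by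
  obtain ⟨v, hvy, hvx⟩ := SetLike.not_le_iff_exists.1 h
  refine ⟨span K {v}, finrank_span_singleton ?_, ?_, ?_⟩
  · rintro rfl
    exact hvx x.zero_mem
  · rwa [span_singleton_le_iff_mem]
  · rwa [span_singleton_le_iff_mem]

variable [Finite V]

lemma exists_span_singleton_of_finrank_eq_one {p : Submodule K V} (hp : finrank K p = 1) :
    ∃ v : V, v ≠ 0 ∧ p = span K {v} := by
  obtain ⟨v, hv, hv0⟩ := p.ne_bot_iff.1 (fun h => by rw [h, finrank_bot] at hp; omega)
  refine ⟨v, hv0, (Submodule.eq_of_le_of_finrank_eq ?_ ?_).symm⟩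
  · rwa [span_singleton_le_iff_mem]
  · rw [finrank_span_singleton hv0, hp]

lemma finrank_sup_point {x p : Submodule K V} (hp : finrank K p = 1) (hpx : ¬ p ≤ x) :
    finrank K (x ⊔ p : Submodule K V) = finrank K x + 1 := by
  have := Submodule.finrank_sup_add_finrank_inf_eq x p
  rw [inf_comm, (finrank_eq_one_inf_eq_bot_iff hp).2 hpx, finrank_bot, hp] at this
  omega

lemma sum_grass_upSum_one (l : ℕ) (φ : Submodule K V → ℝ) (P : Submodule K V → Prop)
    [DecidablePred P] :
    ∑ y ∈ grass K V l, (if P y then upSum 1 φ y else 0) =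
      ∑ z ∈ grass K V 1, φ z * ∑ y ∈ grass K V l, (if P y ∧ z ≤ y then 1 else 0) := by
  simp only [Finset.mul_sum]
  rw [Finset.sum_comm]
  refine Finset.sum_congr rfl fun y _ => ?_
  rw [upSum]
  by_cases h : P y <;> simp [h]

variable [Finite K]

lemma sum_grass_one_le (y : Submodule K V) :
    ∑ z ∈ grass K V 1, (if z ≤ y then (1 : ℝ) else 0) =
      qBinom (Nat.card K) (finrank K y) 1 := by
  rcases Nat.eq_zero_or_pos (finrank K y) with h | h
  · rw [h, qBinom_one_right, pow_zero, sub_self, zero_div]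
    refine Finset.sum_eq_zero fun z hz => if_neg fun hzy => ?_
    have := Submodule.finrank_mono hzy
    rw [mem_grass.1 hz] at this
    omega
  · have := sum_grass_Icc (bot_le : ⊥ ≤ y) (i := 1) (by simp) h
    simpa using this

lemma upSum_one_eq_of_forall {φ : Submodule K V → ℝ} {c : ℝ} {y : Submodule K V}
    (h : ∀ p : Submodule K V, finrank K p = 1 → p ≤ y → φ p = c) :
    upSum 1 φ y = c * qBinom (Nat.card K) (finrank K y) 1 := by
  rw [← sum_grass_one_le, Finset.mul_sum]
  refine Finset.sum_congr rfl fun z hz => ?_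
  split_ifs with hzy
  · rw [h z (mem_grass.1 hz) hzy, mul_one]
  · rw [mul_zero]

lemma exists_grass_between {z y : Submodule K V} (hzy : z ≤ y) {i : ℕ} (hzi : finrank K z ≤ i)
    (hiy : i ≤ finrank K y) : ∃ w : Submodule K V, finrank K w = i ∧ z ≤ w ∧ w ≤ y := by
  have h := sum_grass_Icc hzy hzi hiy
  have hpos := qBinom_pos (one_lt_card_cast K)
    (show i - finrank K z ≤ finrank K y - finrank K z by omega)
  rw [← h] at hpos
  obtain ⟨w, hw, hw2⟩ := Finset.exists_ne_zero_of_sum_ne_zero hpos.ne'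
  exact ⟨w, mem_grass.1 hw, by by_contra hc; exact hw2 (if_neg hc)⟩

lemma exists_grass_disjoint {z x : Submodule K V} (hzx : z ⊓ x = ⊥) {l : ℕ}
    (hzl : finrank K z ≤ l) (h : finrank K x + l ≤ finrank K V) :
    ∃ y : Submodule K V, finrank K y = l ∧ z ≤ y ∧ y ⊓ x = ⊥ := by
  have hpos := numDisjointAbove_pos (one_lt_card_cast K) hzl h
  rw [← sum_grass_Ici_disjoint hzx h] at hpos
  obtain ⟨w, hw, hw2⟩ := Finset.exists_ne_zero_of_sum_ne_zero hpos.ne'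
  exact ⟨w, mem_grass.1 hw, by by_contra hc; exact hw2 (if_neg hc)⟩

/-- If `φ` sums to zero on every `l`-dimensional subspace disjoint from `x`, then `φ` is constant
on the points off `x` in a small overspace of `x`. -/
lemma exists_const_off {φ : Submodule K V → ℝ} {x w : Submodule K V} {l : ℕ} (hl : 1 ≤ l)
    (hx : ∀ y : Submodule K V, finrank K y = l → y ⊓ x = ⊥ → upSum 1 φ y = 0) (hxw : x ≤ w)
    (hw : finrank K w + l ≤ finrank K V + 1) :
    ∃ c : ℝ, ∀ p : Submodule K V, finrank K p = 1 → p ≤ w → ¬ p ≤ x → φ p = c := by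
  -- Sum `upSum 1 φ` over the `l`-spaces `y` with `y ⊓ w = p`. There are `N` of them, and `C` pass
  -- through a given point off `w` (none when `l = 1`). Each is disjoint from `x`, so `N φ(p) + C ∑
  -- φ(z) = 0`, the sum over points off `w`; hence `φ(p)` does not depend on `p`.
  let N : ℝ := (Nat.card K : ℝ) ^ ((finrank K w - 1) * (l - 1)) *
    qBinom (Nat.card K) (finrank K V - 1 - (finrank K w - 1)) (l - 1)
  let C : ℝ := if 2 ≤ l then (Nat.card K : ℝ) ^ ((finrank K w - 1) * (l - 2)) *
    qBinom (Nat.card K) (finrank K V - 2 - (finrank K w - 1)) (l - 2) else 0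
  have hcount (p z : Submodule K V) (hp : finrank K p = 1) (hz : finrank K z = 1) (hpw : p ≤ w) :
      ∑ y ∈ grass K V l, (if (p ≤ y ∧ y ⊓ w ≤ p) ∧ z ≤ y then (1 : ℝ) else 0) =
        (if z = p then N else 0) + if z ≤ w then 0 else C := by
    have hw1 : 1 ≤ finrank K w := hp ▸ Submodule.finrank_mono hpw
    rw [sum_grass_ite_one l fun y => (p ≤ y ∧ y ⊓ w ≤ p) ∧ z ≤ y]
    by_cases hzw : z ≤ w
    · rw [if_pos hzw, add_zero]
      split_ifs with hzp
      · subst hzp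
        have := card_above_inf_le z w l (by omega) (by rw [inf_eq_left.2 hpw]; omega)
        rw [inf_eq_left.2 hpw, hp] at this
        refine Eq.trans ?_ this
        congr 1
        exact Nat.card_congr (Equiv.subtypeEquivRight fun y => by tauto)
      · rw [Nat.cast_eq_zero, Nat.card_eq_zero]
        refine Or.inl ⟨fun ⟨y, hy, ⟨h1, h2⟩, h3⟩ => hzp ?_⟩
        exact Submodule.eq_of_le_of_finrank_eq ((le_inf h3 hzw).trans h2) (hz.trans hp.symm)
    · rw [if_neg hzw, if_neg (by rintro rfl; exact hzw hpw), zero_add]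
      have hzp : ¬ z ≤ p := fun h => hzw (h.trans hpw)
      have hu : finrank K (p ⊔ z : Submodule K V) = 2 := by rw [finrank_sup_point hz hzp, hp]
      have huw : (p ⊔ z) ⊓ w = p := by
        rw [sup_inf_assoc_of_le _ hpw, (finrank_eq_one_inf_eq_bot_iff hz).2 hzw, sup_bot_eq]
      simp only [C]
      split_ifs with hl2
      · have := card_above_inf_le (p ⊔ z) w l (by omega) (by rw [huw]; omega)
        rw [huw, hu, hp] at this
        refine Eq.trans ?_ this
        congr 1
        refine Nat.card_congr (Equiv.subtypeEquivRight fun y => ?_)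
        have : y ⊓ w ≤ p ↔ y ⊓ w ≤ p ⊔ z :=
          ⟨fun h => h.trans le_sup_left, fun h => huw ▸ le_inf h inf_le_right⟩
        rw [sup_le_iff, this]
        tauto
      · rw [Nat.cast_eq_zero, Nat.card_eq_zero]
        refine Or.inl ⟨fun ⟨y, hy, ⟨h1, h2⟩, h3⟩ => hl2 ?_⟩
        rw [← hy, ← hu]
        exact Submodule.finrank_mono (sup_le h1 h3)
  refine ⟨-(∑ z ∈ grass K V 1, φ z * if z ≤ w then 0 else C) / N, fun p hp hpw hpx => ?_⟩
  have hw1 : 1 ≤ finrank K w := hp ▸ Submodule.finrank_mono hpw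
  have hN : 0 < N := by
    have := one_lt_card_cast K
    exact mul_pos (by positivity) (qBinom_pos this (by omega))
  have h0 : ∑ y ∈ grass K V l, (if p ≤ y ∧ y ⊓ w ≤ p then upSum 1 φ y else 0) = 0 := by
    refine Finset.sum_eq_zero fun y hy => ?_
    split_ifs with h
    · refine hx y (mem_grass.1 hy) ?_
      rw [eq_bot_iff, ← (finrank_eq_one_inf_eq_bot_iff hp).2 hpx]
      exact le_inf ((inf_le_inf_left _ hxw).trans h.2) inf_le_right
    · rfl
  rw [sum_grass_upSum_one l φ fun y => p ≤ y ∧ y ⊓ w ≤ p,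
    Finset.sum_congr rfl fun z hz => by rw [hcount p z hp (mem_grass.1 hz) hpw]] at h0
  simp only [mul_add, Finset.sum_add_distrib] at h0
  rw [Finset.sum_eq_single p (fun z _ hzp => by rw [if_neg hzp, mul_zero])
    (fun h => absurd (mem_grass.2 hp) h), if_pos rfl] at h0
  rw [eq_div_iff hN.ne']
  linarith

/-- The extra dimension lets `exists_const_off` be applied to `x ⊔ p ⊔ z`, so any two points off `x`
have equal values. The constant is zero because an `l`-space disjoint from `x` has sum zero. -/
lemma eq_zero_off {φ : Submodule K V → ℝ} {x : Submodule K V} {l : ℕ} (hl : 1 ≤ l)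
    (hx : ∀ y : Submodule K V, finrank K y = l → y ⊓ x = ⊥ → upSum 1 φ y = 0)
    (hn : finrank K x + l + 1 ≤ finrank K V) {p : Submodule K V} (hp : finrank K p = 1)
    (hpx : ¬ p ≤ x) : φ p = 0 := by
  have hconst (z : Submodule K V) (hz : finrank K z = 1) (hzx : ¬ z ≤ x) : φ z = φ p := by
    have h1 := Submodule.finrank_sup_add_finrank_inf_eq (x ⊔ p) z
    have h2 := finrank_sup_point hp hpx
    obtain ⟨c, hc⟩ := exists_const_off hl hx (w := x ⊔ p ⊔ z) (le_sup_left.trans le_sup_left)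
      (by omega)
    rw [hc z hz le_sup_right hzx, hc p hp (le_sup_right.trans le_sup_left) hpx]
  obtain ⟨y, hy, -, hyx⟩ := exists_grass_disjoint (bot_inf_eq x) (l := l) (by simp) (by omega)
  have h := hx y hy hyx
  rw [upSum_one_eq_of_forall (c := φ p)] at h
  · refine (mul_eq_zero.1 h).resolve_right ?_
    exact (qBinom_pos (one_lt_card_cast K) (by omega)).ne'
  · intro z hz hzy
    refine hconst z hz fun hzx => ?_
    have := le_inf hzy hzx
    rw [hyx, le_bot_iff] at this
    rw [this, finrank_bot] at hz
    omega

/-- A function on points whose sums over the hyperplanes of `w` agree is constant on `w`. -/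
lemma exists_const_of_hyperplanes {φ : Submodule K V → ℝ} {w : Submodule K V} {m : ℕ}
    (hm : 1 ≤ m) (hw : finrank K w = m + 1) {S : ℝ}
    (h : ∀ y : Submodule K V, finrank K y = m → y ≤ w → upSum 1 φ y = S) :
    ∃ c : ℝ, ∀ p : Submodule K V, finrank K p = 1 → p ≤ w → φ p = c := by
  -- `A` hyperplanes of `w` pass through a point and `B` through two. Summing over those through `p`
  -- gives `S A = (A - B) φ(p) + B ∑ φ`, which determines `φ(p)` as `A > B`.
  let A : ℝ := qBinom (Nat.card K) m (m - 1)
  let B : ℝ := if 2 ≤ m then qBinom (Nat.card K) (m - 1) (m - 2) else 0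
  have hq := one_lt_card_cast K
  have hAB : 0 < A - B := by
    simp only [A, B]
    split_ifs with h2
    · obtain ⟨b, rfl⟩ := Nat.exists_eq_add_of_le' h2
      rw [show b + 2 - 1 = b + 1 by omega, show b + 2 - 2 = b by omega, qBinom_succ_succ]
      have h1 := qBinom_pos hq (show b ≤ b + 1 by omega)
      have h3 := pow_sub_one_pos hq (show b + 1 ≠ 0 by omega)
      have h4 : 1 < ((Nat.card K : ℝ) ^ (b + 1 + 1) - 1) / ((Nat.card K : ℝ) ^ (b + 1) - 1) := by
        rw [one_lt_div h3]
        have := pow_lt_pow_right₀ hq (show b + 1 < b + 1 + 1 by omega)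
        linarith
      nlinarith
    · rw [sub_zero]
      exact qBinom_pos hq (by omega)
  have hcount (p z : Submodule K V) (hp : finrank K p = 1) (hz : finrank K z = 1) (hpw : p ≤ w) :
      ∑ y ∈ grass K V m, (if (p ≤ y ∧ y ≤ w) ∧ z ≤ y then (1 : ℝ) else 0) =
        (if z = p then A - B else 0) + if z ≤ w then B else 0 := by
    by_cases hzw : z ≤ w
    · rw [if_pos hzw]
      have e : ∑ y ∈ grass K V m, (if (p ≤ y ∧ y ≤ w) ∧ z ≤ y then (1 : ℝ) else 0) =
          ∑ y ∈ grass K V m, (if p ⊔ z ≤ y ∧ y ≤ w then (1 : ℝ) else 0) :=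
        Finset.sum_congr rfl fun y _ => if_congr (by rw [sup_le_iff]; tauto) rfl rfl
      rw [e]
      split_ifs with hzp
      · subst hzp
        rw [sup_idem, sum_grass_Icc hpw (by omega) (by omega), hp, hw, sub_add_cancel]
        rfl
      · have hzp' : ¬ z ≤ p := fun hle =>
          hzp (Submodule.eq_of_le_of_finrank_eq hle (hz.trans hp.symm))
        have hu : finrank K (p ⊔ z : Submodule K V) = 2 := by rw [finrank_sup_point hz hzp', hp]
        rw [zero_add]
        simp only [B]
        split_ifs with h2
        · rw [sum_grass_Icc (sup_le hpw hzw) (by omega) (by omega), hu, hw]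
          rfl
        · refine Finset.sum_eq_zero fun y hy => if_neg fun hle => h2 ?_
          rw [← mem_grass.1 hy, ← hu]
          exact Submodule.finrank_mono hle.1
    · rw [if_neg hzw, if_neg (by rintro rfl; exact hzw hpw), zero_add]
      exact Finset.sum_eq_zero fun y _ => if_neg fun hle => hzw (hle.2.trans hle.1.2)
  refine ⟨(S * A - B * upSum 1 φ w) / (A - B), fun p hp hpw => ?_⟩
  have h0 : ∑ y ∈ grass K V m, (if p ≤ y ∧ y ≤ w then upSum 1 φ y else 0) = S * A := by
    have hA := sum_grass_Icc hpw (i := m) (by omega) (by omega)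
    rw [hp, hw, Nat.add_sub_cancel] at hA
    rw [show A = _ from hA.symm, Finset.mul_sum]
    refine Finset.sum_congr rfl fun y hy => ?_
    split_ifs with hle
    · rw [h y (mem_grass.1 hy) hle.2, mul_one]
    · rw [mul_zero]
  rw [sum_grass_upSum_one m φ fun y => p ≤ y ∧ y ≤ w,
    Finset.sum_congr rfl fun z hz => by rw [hcount p z hp (mem_grass.1 hz) hpw]] at h0
  simp only [mul_add, Finset.sum_add_distrib] at h0
  rw [Finset.sum_eq_single p (fun z _ hzp => by rw [if_neg hzp, mul_zero])
    (fun h => absurd (mem_grass.2 hp) h), if_pos rfl] at h0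
  have h1 : ∑ z ∈ grass K V 1, φ z * (if z ≤ w then B else 0) = B * upSum 1 φ w := by
    rw [upSum, Finset.mul_sum]
    exact Finset.sum_congr rfl fun z _ => by split_ifs <;> ring
  rw [eq_div_iff hAB.ne']
  linarith

end Structure

/-! ### The extremal families when `n = 2k`. -/

section Extremal

open scoped Classical

variable {K V : Type*} [Field K] [Finite K] [AddCommGroup V] [Module K V] [Finite V]

/-- An intersecting family of `k`-dimensional subspaces of a `2 * k`-dimensional space whose
indicator function has degree one lies in a point-pencil or in a hyperplane. -/
lemma exists_point_or_hyperplane {k : ℕ} (hk : 1 ≤ k) (hn : finrank K V = 2 * k)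
    {F : Set (Submodule K V)} (hF : F ⊆ subspacesOfDim K V k) (hFF : CrossIntersecting F F)
    (hne : F.Nonempty) {φ : Submodule K V → ℝ}
    (hφ : ∀ x ∈ grass K V k, upSum 1 φ x = if x ∈ F then 1 else 0) :
    (∃ p : Submodule K V, finrank K p = 1 ∧ ∀ x ∈ F, p ≤ x) ∨
      ∃ H : Submodule K V, finrank K H = 2 * k - 1 ∧ ∀ x ∈ F, x ≤ H := by
  have hFk {x : Submodule K V} (hx : x ∈ F) : finrank K x = k := hF hx
  have hφ1 {x : Submodule K V} (hx : x ∈ F) : upSum 1 φ x = 1 := by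
    rw [hφ x (mem_grass.2 (hFk hx)), if_pos hx]
  have hmem {x : Submodule K V} (hx : finrank K x = k) (h : upSum 1 φ x = 1) : x ∈ F := by
    by_contra hxF
    rw [hφ x (mem_grass.2 hx), if_neg hxF] at h
    exact zero_ne_one h
  have hoff {x : Submodule K V} (hx : x ∈ F) (y : Submodule K V) (hy : finrank K y = k)
      (hyx : y ⊓ x = ⊥) : upSum 1 φ y = 0 := by
    rw [hφ y (mem_grass.2 hy), if_neg fun h => hFF y h x hx hyx]
  have hq := one_lt_card_cast K
  by_cases hstar : ∀ x ∈ F, ∀ p : Submodule K V, finrank K p = 1 → ¬ p ≤ x → φ p = 0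
  · left
    obtain ⟨x, hx⟩ := hne
    have h1 : upSum 1 φ x ≠ 0 := by rw [hφ1 hx]; exact one_ne_zero
    obtain ⟨p, hp, hp0⟩ := Finset.exists_ne_zero_of_sum_ne_zero h1
    have hp0 : φ p ≠ 0 := fun h => hp0 (by rw [h, ite_self])
    exact ⟨p, mem_grass.1 hp, fun y hy => by
      by_contra hpy
      exact hp0 (hstar y hy p (mem_grass.1 hp) hpy)⟩
  right
  push Not at hstar
  obtain ⟨x, hx, p₀, hp₀, hp₀x, hφp₀⟩ := hstar
  obtain ⟨y₀, hy₀, hpy₀, hy₀x⟩ := exists_grass_disjoint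
    ((finrank_eq_one_inf_eq_bot_iff hp₀).2 hp₀x) (l := k) (by omega) (by rw [hFk hx]; omega)
  have hy₀off (p : Submodule K V) (hp : finrank K p = 1) (hpy : p ≤ y₀) : ¬ p ≤ x := fun h => by
    have := le_inf hpy h
    rw [hy₀x, le_bot_iff] at this
    rw [this, finrank_bot] at hp
    omega
  have hsum : ∑ z ∈ grass K V 1 with z ≤ y₀, φ z = 0 := by
    rw [Finset.sum_filter]
    exact hoff hx y₀ hy₀ hy₀x
  have hp₀mem : p₀ ∈ (grass K V 1).filter (· ≤ y₀) :=
    Finset.mem_filter.2 ⟨mem_grass.2 hp₀, hpy₀⟩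
  -- The sum of `φ` over `y₀` is zero but `φ p₀ ≠ 0`, so `φ` takes both signs on the points of `y₀`,
  -- all of which lie off `x`.
  obtain ⟨p₁, hp₁, hφp₁⟩ := Finset.exists_pos_of_sum_zero_of_exists_nonzero _ hsum
    ⟨p₀, hp₀mem, hφp₀⟩
  obtain ⟨p₂, hp₂, hφp₂⟩ := Finset.exists_pos_of_sum_zero_of_exists_nonzero (fun z => -φ z)
    (by rw [Finset.sum_neg_distrib, hsum, neg_zero]) ⟨p₀, hp₀mem, neg_ne_zero.2 hφp₀⟩
  rw [Finset.mem_filter, mem_grass] at hp₁ hp₂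
  have hp₁x := hy₀off p₁ hp₁.1 hp₁.2
  have hp₂x := hy₀off p₂ hp₂.1 hp₂.2
  replace hp₁ := hp₁.1
  replace hp₂ := hp₂.1
  -- constancy of `φ` on the points off a member of the family
  have hconst {x' p : Submodule K V} (hx' : x' ∈ F) (hp : finrank K p = 1) (hpx : ¬ p ≤ x')
      (z : Submodule K V) (hz : finrank K z = 1) (hzw : z ≤ x' ⊔ p) (hzx : ¬ z ≤ x') :
      φ z = φ p := by
    obtain ⟨c, hc⟩ := exists_const_off hk (hoff hx') (le_sup_left : x' ≤ x' ⊔ p)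
      (by rw [finrank_sup_point hp hpx, hFk hx']; omega)
    rw [hc z hz hzw hzx, hc p hp le_sup_right hpx]
  -- The number of points of a `k`-space outside a hyperplane of it.
  let N : ℝ := qBinom (Nat.card K) k 1 - qBinom (Nat.card K) (k - 1) 1
  have hN : 0 < N := by
    simp only [N, qBinom_one_right]
    rw [← sub_div]
    have := pow_lt_pow_right₀ hq (show k - 1 < k by omega)
    exact div_pos (by linarith) (by linarith)
  have hexch (h p : Submodule K V) (hhx : h ≤ x) (hh : finrank K h = k - 1)
      (hp : finrank K p = 1) (hpx : ¬ p ≤ x) :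
      upSum 1 φ (h ⊔ p) = upSum 1 φ h + N * φ p := by
    have hd : finrank K (h ⊔ p : Submodule K V) = k := by
      rw [finrank_sup_point hp fun hle => hpx (hle.trans hhx), hh]
      omega
    have hinf : (h ⊔ p) ⊓ x = h := by
      rw [sup_inf_assoc_of_le _ hhx, (finrank_eq_one_inf_eq_bot_iff hp).2 hpx, sup_bot_eq]
    have h1 : N = ∑ z ∈ grass K V 1, if z ≤ h ⊔ p ∧ ¬ z ≤ h then (1 : ℝ) else 0 := by
      simp only [N]
      rw [← hh]
      conv_lhs => rw [← hd]
      rw [← sum_grass_one_le, ← sum_grass_one_le, ← Finset.sum_sub_distrib]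
      refine Finset.sum_congr rfl fun z _ => ?_
      by_cases hz : z ≤ h
      · simp [hz, hz.trans le_sup_left]
      · simp [hz]
    rw [h1, upSum, upSum, Finset.sum_mul, ← Finset.sum_add_distrib]
    refine Finset.sum_congr rfl fun z hz => ?_
    by_cases hzh : z ≤ h
    · simp [hzh, hzh.trans le_sup_left]
    · by_cases hzp : z ≤ h ⊔ p
      · have hzx : ¬ z ≤ x := fun hle => hzh (hinf ▸ le_inf hzp hle)
        simp only [hzp, hzh, not_false_eq_true, and_self, if_true, if_false, zero_add, one_mul]
        exact hconst hx hp hpx z (mem_grass.1 hz) (hzp.trans (sup_le_sup_right hhx _)) hzx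
      · simp [hzh, hzp]
  have hval (h p : Submodule K V) (hhx : h ≤ x) (hh : finrank K h = k - 1)
      (hp : finrank K p = 1) (hpx : ¬ p ≤ x) :
      upSum 1 φ h + N * φ p = 1 ∨ upSum 1 φ h + N * φ p = 0 := by
    have hd : finrank K (h ⊔ p : Submodule K V) = k := by
      rw [finrank_sup_point hp fun hle => hpx (hle.trans hhx), hh]
      omega
    rw [← hexch h p hhx hh hp hpx, hφ _ (mem_grass.2 hd)]
    split_ifs <;> simp
  -- The sums on `h ⊔ p₁` and `h ⊔ p₂` both lie in `{0, 1}`, and the first is strictly larger, so it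
  -- is 1.
  have hhyp (h : Submodule K V) (hhx : h ≤ x) (hh : finrank K h = k - 1) :
      upSum 1 φ h + N * φ p₁ = 1 := by
    refine (hval h p₁ hhx hh hp₁ hp₁x).resolve_right fun h0 => ?_
    have h1 : N * φ p₂ < N * φ p₁ := mul_lt_mul_of_pos_left (by linarith) hN
    rcases hval h p₂ hhx hh hp₂ hp₂x with h2 | h2 <;> linarith
  have hle_off (p : Submodule K V) (hp : finrank K p = 1) (hpx : ¬ p ≤ x) : φ p ≤ φ p₁ := by
    obtain ⟨h, hh, -, hhx⟩ := exists_grass_between (bot_le : ⊥ ≤ x) (i := k - 1) (by simp)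
      (by rw [hFk hx]; omega)
    refine le_of_mul_le_mul_left ?_ hN
    have h1 := hhyp h hhx hh
    rcases hval h p hhx hh hp hpx with h2 | h2 <;> linarith
  -- all hyperplanes of `x ⊔ p₁` belong to the family
  have hw : finrank K (x ⊔ p₁ : Submodule K V) = k + 1 := by
    rw [finrank_sup_point hp₁ hp₁x, hFk hx]
  have hwall (y : Submodule K V) (hy : finrank K y = k) (hyw : y ≤ x ⊔ p₁) :
      upSum 1 φ y = 1 := by
    by_cases hyx : y ≤ x
    · rw [Submodule.eq_of_le_of_finrank_eq hyx (hy.trans (hFk hx).symm), hφ1 hx]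
    · obtain ⟨p, hp, hpy, hpx⟩ := exists_point_not_le hyx
      have h1 := Submodule.finrank_sup_add_finrank_inf_eq y x
      have h2 := Submodule.finrank_mono (sup_le hyw le_sup_left : y ⊔ x ≤ x ⊔ p₁)
      have h3 := Submodule.finrank_mono (sup_le le_sup_right (hpy.trans le_sup_left) :
        x ⊔ p ≤ y ⊔ x)
      rw [finrank_sup_point hp hpx, hFk hx] at h3
      rw [hy, hFk hx] at h1
      have hh : finrank K (y ⊓ x : Submodule K V) = k - 1 := by omega
      have hsup : y ⊓ x ⊔ p = y := by
        refine Submodule.eq_of_le_of_finrank_eq (sup_le inf_le_left hpy) ?_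
        rw [finrank_sup_point hp fun hle => hpx (hle.trans inf_le_right), hh, hy]
        omega
      rw [← hsup, hexch _ p inf_le_right hh hp hpx,
        hconst hx hp₁ hp₁x p hp (hpy.trans hyw) hpx]
      exact hhyp _ inf_le_right hh
  obtain ⟨c, hc⟩ := exists_const_of_hyperplanes hk hw hwall
  have hc1 : φ p₁ = c := hc p₁ hp₁ le_sup_right
  -- So `c` is the maximum of `φ`. As `c` times the number of points of a `k`-space is 1, a
  -- `k`-space lies in `F` exactly when `φ = c` on all its points.
  have hcle (p : Submodule K V) (hp : finrank K p = 1) : φ p ≤ c := by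
    by_cases hpx : p ≤ x
    · exact (hc p hp (hpx.trans le_sup_left)).le
    · exact hc1 ▸ hle_off p hp hpx
  have hck : c * qBinom (Nat.card K) k 1 = 1 := by
    rw [← hφ1 hx, upSum_one_eq_of_forall fun p hp hpx => hc p hp (hpx.trans le_sup_left), hFk hx]
  have hF_of {y : Submodule K V} (hy : finrank K y = k)
      (h : ∀ p : Submodule K V, finrank K p = 1 → p ≤ y → φ p = c) : y ∈ F :=
    hmem hy (by rw [upSum_one_eq_of_forall h, hy, hck])
  have hF_to {y : Submodule K V} (hy : y ∈ F) (p : Submodule K V) (hp : finrank K p = 1)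
      (hpy : p ≤ y) : φ p = c := by
    have h1 : ∑ z ∈ grass K V 1, (if z ≤ y then c - φ z else 0) = 0 := by
      have h2 := sum_grass_one_le y
      have h3 := hφ1 hy
      have h4 (z : Submodule K V) : (if z ≤ y then c - φ z else 0) =
          c * (if z ≤ y then 1 else 0) - if z ≤ y then φ z else 0 := by
        split_ifs <;> simp
      rw [Finset.sum_congr rfl fun z _ => h4 z, Finset.sum_sub_distrib, ← Finset.mul_sum, h2,
        hFk hy, hck, sub_eq_zero]
      exact h3.symm
    rw [Finset.sum_eq_zero_iff_of_nonneg] at h1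
    · have := h1 p (mem_grass.2 hp)
      rw [if_pos hpy] at this
      linarith
    · intro z hz
      split_ifs
      · linarith [hcle z (mem_grass.1 hz)]
      · exact le_rfl
  have hext {x' p : Submodule K V} (hx' : x' ∈ F) (hp : finrank K p = 1) (hpc : φ p = c)
      (z : Submodule K V) (hz : finrank K z = 1) (hzw : z ≤ x' ⊔ p) : φ z = c := by
    by_cases hzx : z ≤ x'
    · exact hF_to hx' z hz hzx
    · have hpx : ¬ p ≤ x' := fun h => hzx (by rwa [sup_eq_left.2 h] at hzw)
      rw [hconst hx' hp hpx z hz hzw hzx, hpc]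
  have hcov {p : Submodule K V} (hp : finrank K p = 1) (hpc : φ p = c) :
      ∃ x' ∈ F, p ≤ x' := by
    obtain ⟨y, hy, hpy, hyw⟩ := exists_grass_between (le_sup_right : p ≤ x ⊔ p) (i := k)
      (by omega) ((hFk hx).symm.trans_le (Submodule.finrank_mono le_sup_left))
    exact ⟨y, hF_of hy fun z hz hzy => hext hx hp hpc z hz (hzy.trans hyw), hpy⟩
  -- The points of maximal value form a subspace: one of two such points lies in some `x' ∈ F` by
  -- `hcov`, and `φ = c` on the join of `x'` with the other by `hext`. It is proper because `φ p₂ <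
  -- 0`.
  let U : Submodule K V :=
    { carrier := {v | v = 0 ∨ φ (span K {v}) = c}
      zero_mem' := Or.inl rfl
      smul_mem' := by
        rintro a v (rfl | hv)
        · exact Or.inl (smul_zero a)
        · rcases eq_or_ne a 0 with rfl | ha
          · exact Or.inl (zero_smul K v)
          · right
            rwa [span_singleton_smul_eq (IsUnit.mk0 a ha)]
      add_mem' := by
        intro v v' hv hv'
        rcases eq_or_ne v 0 with rfl | hv0
        · rwa [zero_add]
        rcases eq_or_ne v' 0 with rfl | hv0'
        · rwa [add_zero]
        rcases eq_or_ne (v + v') 0 with hvv | hvv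
        · exact Or.inl hvv
        right
        obtain ⟨x', hx', hvx'⟩ := hcov (finrank_span_singleton hv0) (hv.resolve_left hv0)
        refine hext hx' (finrank_span_singleton hv0') (hv'.resolve_left hv0') _
          (finrank_span_singleton hvv) ?_
        rw [span_singleton_le_iff_mem] at hvx' ⊢
        exact add_mem (mem_sup_left hvx') (mem_sup_right (mem_span_singleton_self v')) }
  have hUtop : finrank K U < finrank K V := by
    refine Submodule.finrank_lt fun htop => ?_
    obtain ⟨v, hv0, rfl⟩ := exists_span_singleton_of_finrank_eq_one hp₂
    have hvU : v ∈ U := htop ▸ mem_top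
    have : φ (span K {v}) = c := Or.resolve_left hvU hv0
    linarith
  obtain ⟨H, hH, hUH, -⟩ := exists_grass_between (le_top : U ≤ ⊤) (i := 2 * k - 1) (by omega)
    (by rw [finrank_top]; omega)
  refine ⟨H, hH, fun y hy => le_trans (fun v hv => ?_) hUH⟩
  rcases eq_or_ne v 0 with rfl | hv0
  · exact zero_mem _
  · exact Or.inr (hF_to hy _ (finrank_span_singleton hv0) (by rwa [span_singleton_le_iff_mem]))

end Extremal

/-- Reduces the characterization of equality to containment in an extremal pair. -/
lemma eq_and_eq_of_ncard_mul_eq {α : Type*} [Finite α] {F F' G G' : Set α} (hF : F ⊆ F') (hG : G ⊆ G')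
    (h : (F.ncard : ℝ) * G.ncard = F'.ncard * G'.ncard) (hF0 : 0 < (F'.ncard : ℝ))
    (hG0 : 0 < (G'.ncard : ℝ)) : F = F' ∧ G = G' := by
  have h1 := Set.ncard_le_ncard hF
  have h2 := Set.ncard_le_ncard hG
  norm_cast at h hF0 hG0
  refine ⟨Set.eq_of_subset_of_ncard_le hF ?_, Set.eq_of_subset_of_ncard_le hG ?_⟩
  · by_contra! hlt
    have := Nat.mul_lt_mul_of_lt_of_le hlt h2 hG0
    omega
  · by_contra! hlt
    have := Nat.mul_lt_mul_of_le_of_lt h1 hlt hF0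
    omega

/-! ### Sizes of the extremal families and the case of equality. -/

section Main

variable {K V : Type*} [Field K] [Finite K] [AddCommGroup V] [Module K V] [Finite V]

lemma ncard_star {z : Submodule K V} (hz : finrank K z = 1) {k : ℕ} (hk : 1 ≤ k)
    (hkn : k ≤ finrank K V) : ({x ∈ subspacesOfDim K V k | z ≤ x}.ncard : ℝ) =
      qBinom (Nat.card K) (finrank K V - 1) (k - 1) := by
  have := card_Icc z ⊤ le_top k (by omega) (by rwa [finrank_top])
  rw [finrank_top, hz] at this
  rw [← this, ← Nat.card_coe_set_eq]
  congr 1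
  exact Nat.card_congr (Equiv.subtypeEquivRight fun y => by simp [subspacesOfDim])

/-- The direct count is of `k`-spaces in dimension `2k - 1`; the symmetry `k ↔ k - 1` shows that it
equals the size of a point-pencil. -/
lemma ncard_hyperplane {k : ℕ} (hk : 1 ≤ k) {z : Submodule K V} (hz : finrank K z = 2 * k - 1) :
    ({x ∈ subspacesOfDim K V k | x ≤ z}.ncard : ℝ) = qBinom (Nat.card K) (2 * k - 1) (k - 1) := by
  have := card_Icc ⊥ z bot_le k (by simp) (by omega)
  rw [finrank_bot, hz, Nat.sub_zero, Nat.sub_zero] at this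
  have hsymm := qBinom_symm (one_lt_card_cast K) (k - 1) k
  rw [show k - 1 + k = 2 * k - 1 by omega] at hsymm
  rw [← hsymm, ← this, ← Nat.card_coe_set_eq]
  congr 1
  exact Nat.card_congr (Equiv.subtypeEquivRight fun y => by simp [subspacesOfDim])

lemma crossIntersecting_extremal {k l : ℕ} (hk : 1 ≤ k) (hl : 1 ≤ l)
    (hnk : 2 * k ≤ finrank K V) (hnl : 2 * l ≤ finrank K V) {F G : Set (Submodule K V)}
    (hF : F ⊆ subspacesOfDim K V k) (hG : G ⊆ subspacesOfDim K V l) (hFG : CrossIntersecting F G)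
    (heq : (F.ncard : ℝ) * G.ncard = qBinom (Nat.card K) (finrank K V - 1) (k - 1) *
      qBinom (Nat.card K) (finrank K V - 1) (l - 1)) :
    (∃ z ∈ subspacesOfDim K V 1,
        F = {x ∈ subspacesOfDim K V k | z ≤ x} ∧ G = {x ∈ subspacesOfDim K V l | z ≤ x}) ∨
      (finrank K V = 2 * k ∧ finrank K V = 2 * l ∧ ∃ z ∈ subspacesOfDim K V (2 * k - 1),
        F = {x ∈ subspacesOfDim K V k | x ≤ z} ∧ G = {x ∈ subspacesOfDim K V k | x ≤ z}) := by
  have hq := one_lt_card_cast K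
  have hA : 0 < qBinom (Nat.card K : ℝ) (finrank K V - 1) (k - 1) := qBinom_pos hq (by omega)
  have hB : 0 < qBinom (Nat.card K : ℝ) (finrank K V - 1) (l - 1) := qBinom_pos hq (by omega)
  obtain ⟨φ, s, hs, hφF, hφG⟩ := (crossIntersecting_bound hk hl hnk hnl hF hG hFG).2 heq
  have hFne : F.Nonempty := by
    rw [Set.nonempty_iff_ne_empty]
    rintro rfl
    rw [Set.ncard_empty, Nat.cast_zero, zero_mul] at heq
    exact (mul_pos hA hB).ne heq
  have hstar (p : Submodule K V) (hp : finrank K p = 1) (h1 : ∀ x ∈ F, p ≤ x)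
      (h2 : ∀ y ∈ G, p ≤ y) : ∃ z ∈ subspacesOfDim K V 1,
        F = {x ∈ subspacesOfDim K V k | z ≤ x} ∧ G = {x ∈ subspacesOfDim K V l | z ≤ x} := by
    refine ⟨p, hp, eq_and_eq_of_ncard_mul_eq (fun x hx => ⟨hF hx, h1 x hx⟩)
      (fun y hy => ⟨hG hy, h2 y hy⟩) ?_ ?_ ?_⟩
    · rw [ncard_star hp hk (by omega), ncard_star hp hl (by omega), heq]
    · rwa [ncard_star hp hk (by omega)]
    · rwa [ncard_star hp hl (by omega)]
  rcases Nat.lt_or_ge (k + l) (finrank K V) with hlt | hge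
  · left
    have hoffF {x : Submodule K V} (hx : x ∈ F) {p : Submodule K V} (hp : finrank K p = 1)
        (hpx : ¬ p ≤ x) : φ p = 0 := by
      have hxk : finrank K x = k := hF hx
      refine eq_zero_off hl (fun y hy hyx => ?_) (by omega) hp hpx
      rw [hφG y (mem_grass.2 hy), if_neg fun h => hFG x hx y h (by rwa [inf_comm])]
    have hoffG {y : Submodule K V} (hy : y ∈ G) {p : Submodule K V} (hp : finrank K p = 1)
        (hpy : ¬ p ≤ y) : φ p = 0 := by
      have hyl : finrank K y = l := hG hy
      refine eq_zero_off hk (fun x hx hxy => ?_) (by omega) hp hpy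
      rw [hφF x (mem_grass.2 hx), if_neg fun h => hFG x h y hy hxy]
    obtain ⟨x, hx⟩ := hFne
    have h1 : upSum 1 φ x ≠ 0 := by
      rw [hφF x (mem_grass.2 (hF hx)), if_pos hx]
      exact hs.ne'
    obtain ⟨p, hp, hp0⟩ := Finset.exists_ne_zero_of_sum_ne_zero h1
    have hp0 : φ p ≠ 0 := fun h => hp0 (by rw [h, ite_self])
    have hp := mem_grass.1 hp
    refine hstar p hp (fun x hx => ?_) fun y hy => ?_
    · by_contra h
      exact hp0 (hoffF hx hp h)
    · by_contra h
      exact hp0 (hoffG hy hp h)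
  -- From `k + l ≥ n`, `n ≥ 2k` and `n ≥ 2l` it follows that `n = 2k = 2l`.
  · obtain rfl : k = l := by omega
    -- Now `F` and `G` are read off the same function on `k`-spaces: its value `s > 0` at a member
    -- of `F` must also be `s⁻¹` or 0.
    have hs1 : s = 1 := by
      obtain ⟨x, hx⟩ := hFne
      have h1 := hφF x (mem_grass.2 (hF hx))
      rw [hφG x (mem_grass.2 (hF hx)), if_pos hx] at h1
      split_ifs at h1
      · have h2 : s * s = 1 := by
          nth_rewrite 1 [← h1]
          exact inv_mul_cancel₀ hs.ne'
        nlinarith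
      · exact absurd h1.symm hs.ne'
    subst hs1
    rw [inv_one] at hφG
    have hGF : G = F := by
      have h (x : Submodule K V) (hx : finrank K x = k) : x ∈ G ↔ x ∈ F := by
        have h1 := hφF x (mem_grass.2 hx)
        rw [hφG x (mem_grass.2 hx)] at h1
        by_cases hxF : x ∈ F <;> by_cases hxG : x ∈ G <;> simp_all
      exact Set.ext fun x => ⟨fun hx => (h x (hG hx)).1 hx, fun hx => (h x (hF hx)).2 hx⟩
    subst hGF
    rcases exists_point_or_hyperplane hk (by omega) hF hFG hFne hφF with ⟨p, hp, h⟩ | ⟨H, hH, h⟩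
    · exact Or.inl (hstar p hp h h)
    · refine Or.inr ⟨by omega, by omega, H, hH, ?_⟩
      have hc := ncard_hyperplane hk hH
      rw [show 2 * k - 1 = finrank K V - 1 by omega] at hc
      refine eq_and_eq_of_ncard_mul_eq (fun x hx => ⟨hF hx, h x hx⟩)
        (fun x hx => ⟨hF hx, h x hx⟩) ?_ ?_ ?_
      · rw [hc, heq]
      · rwa [hc]
      · rwa [hc]

end Main

theorem theorem1 {K V : Type*} [Field K] [Finite K] [AddCommGroup V] [Module K V]
    [FiniteDimensional K V] (n k l : ℕ) (hn : Module.finrank K V = n)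
    (hk : 1 ≤ k) (hl : 1 ≤ l) (hnk : 2 * k ≤ n) (hnl : 2 * l ≤ n)
    (F G : Set (Submodule K V))
    (hF : F ⊆ subspacesOfDim K V k) (hG : G ⊆ subspacesOfDim K V l)
    (hFG : CrossIntersecting F G) :
    (F.ncard : ℚ) * (G.ncard : ℚ) ≤
        gaussianCoeff (Nat.card K) (n - 1) (k - 1) * gaussianCoeff (Nat.card K) (n - 1) (l - 1) ∧
      ((F.ncard : ℚ) * (G.ncard : ℚ) =
          gaussianCoeff (Nat.card K) (n - 1) (k - 1) *
            gaussianCoeff (Nat.card K) (n - 1) (l - 1) ↔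
        (∃ z ∈ subspacesOfDim K V 1,
            F = {x ∈ subspacesOfDim K V k | z ≤ x} ∧ G = {x ∈ subspacesOfDim K V l | z ≤ x}) ∨
        (n = 2 * k ∧ n = 2 * l ∧ ∃ z ∈ subspacesOfDim K V (2 * k - 1),
            F = {x ∈ subspacesOfDim K V k | x ≤ z} ∧
              G = {x ∈ subspacesOfDim K V k | x ≤ z})) := by
  have := Module.finite_of_finite K (M := V)
  subst hn
  obtain ⟨hle, -⟩ := crossIntersecting_bound hk hl hnk hnl hF hG hFG
  rw [← gaussianCoeff_cast, ← gaussianCoeff_cast] at hle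
  refine ⟨by exact_mod_cast hle, fun heq => ?_, ?_⟩
  · refine crossIntersecting_extremal hk hl hnk hnl hF hG hFG ?_
    rw [← gaussianCoeff_cast, ← gaussianCoeff_cast]
    exact_mod_cast heq
  · have hcast (h : (F.ncard : ℝ) * G.ncard =
        qBinom (Nat.card K) (Module.finrank K V - 1) (k - 1) *
          qBinom (Nat.card K) (Module.finrank K V - 1) (l - 1)) :
        (F.ncard : ℚ) * (G.ncard : ℚ) =
          gaussianCoeff (Nat.card K) (Module.finrank K V - 1) (k - 1) *
            gaussianCoeff (Nat.card K) (Module.finrank K V - 1) (l - 1) := by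
      rw [← gaussianCoeff_cast, ← gaussianCoeff_cast] at h
      exact_mod_cast h
    rintro (⟨z, hz, rfl, rfl⟩ | ⟨h1, h2, z, hz, rfl, rfl⟩)
    · exact hcast (by rw [ncard_star hz hk (by omega), ncard_star hz hl (by omega)])
    · obtain rfl : k = l := by omega
      exact hcast (by rw [ncard_hyperplane hk hz, h1])
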